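/- **Model.** Fix $q\ge 1$. For every $n$ let $p=p(n)\ge 1$, $T=n+q-1$, and let $0=t_0<t_1<\dots<t_{m_0}<t_{m_0+1}=T+1$ be break points, $m_0=m_0(n)$. For each segment $j=1,\dots,m_0+1$ let $\Phi^{(\cdot,j)}=(\Phi^{(1,j)}\ \cdots\ \Phi^{(q,j)})\in\mathbb R^{p\times pq}$ and let $\Sigma_j$ be a $p\times p$ covariance matrix. Let $(\varepsilon_t)_{t\in\mathbb Z}$ be i.i.d. $N(0,I_p)$. The observed series satisfies $$y_t=\Phi^{(1,j)}y_{t-1}+\dots+\Phi^{(q,j)}y_{t-q}+\Sigma_j^{1/2}\varepsilon_t\qquad (t_{j-1}\le t<t_j,\ 1\le j\le m_0+1),$$ and $y_t=y^{(1)}_t$ for $t<t_1$, where $y^{(1)}$ is the stationary process of the first segment introduced in A1. (All quantities may depend on $n$, except $q$ and the constants $a,b,M_\Phi,C$.) **Regression form.** Put $\theta_1=$ the coefficient matrix $\Phi^{(\cdot,j)}$ in force at time $q$ (so $\theta_1=\Phi^{(\cdot,1)}$ if $t_1>q$), and for $i=2,\dots,n$ put $\theta_i=\Phi^{(\cdot,j+1)}-\Phi^{(\cdot,j)}$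 if $q+i-1=t_j$ for some $1\le j\le m_0$, and $\theta_i=0$ otherwise. Let $\mathcal Y$ be the $n\times p$ matrix with rows $y_q',\dots,y_T'$; let $\mathcal X$ be the $n\times npq$ block lower triangular matrix whose $r$-th row has the entry $(y_{q+r-2}',\dots,y_{r-1}')$ in each of the block columns $1,\dots,r$ and $0$ in the others; let $\mathbf Y=\mathrm{vec}(\mathcal Y)$, $\mathbf Z=I_p\otimes\mathcal X$, and let $\mathbf\Theta$ be the vectorization of the matrix with block rows $\theta_1',\dots,\theta_n'$. With the entrywise $\ell_1$ norm $\|\cdot\|_1$, let $\widehat{\mathbf\Theta}$ be any minimizer over $\mathbf\Theta$ of $$\frac1n\|\mathbf Y-\mathbf Z\mathbf\Theta\|_2^2+\lambda_{1,n}\|\mathbf\Theta\|_1+\lambda_{2,n}\sum_{k=1}^n\Big\|\sum_{j=1}^k\theta_j\Big\|_1 .$$ Let $d_{kj}$ be the number of nonzero entries in row $k$ of $\Phi^{(\cdot,j)}$, $d_{k0}=0$, and $d_n^\star=\sum_{j=1}^{m_0+1}\sum_{k=1}^p d_{kj}$. **Assumptions.** A1. For every $n$ and every $j$ there is a stationary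 Gaussian process $(y^{(j)}_t)_{t\in\mathbb Z}$ with $y^{(j)}_t=\Phi^{(1,j)}y^{(j)}_{t-1}+\dots+\Phi^{(q,j)}y^{(j)}_{t-q}+\Sigma_j^{1/2}\varepsilon_t$ and with $\varepsilon_t$ independent of $(y_s^{(j)})_{s<t}$. With $\Gamma_j(h)=\mathrm{cov}(y^{(j)}_t,y^{(j)}_{t+h})$, its spectral density $f_j(\kappa)=\frac1{2\pi}\sum_{l\in\mathbb Z}\Gamma_j(l)e^{-i\kappa l}$ exists (the series converges absolutely), and there are constants $0<a\le b<\infty$ that do not depend on $n$ and $j$ such that, for almost every $\kappa\in[-\pi,\pi]$, all eigenvalues of $f_j(\kappa)$ lie in $[a,b]$. A2. $\max_{1\le k\le p,\,1\le j\le m_0}d_{kj}/p\to0$, and there is a constant $M_\Phi>0$ such that for all $n$ and $1\le j\le m_0+1$ all entries of $\Phi^{(\cdot,j)}$ are at most $M_\Phi$ in absolute value. Spacing. $\min_{1\le j<m_0}(t_{j+1}-t_j)\to\infty$ as $n\to\infty$ (no condition for those $n$ with $m_0\le1$). **Theorem 1.** Under A1, A2 and the spacing condition there is a constant $C_0>0$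 such that the following holds for every $C\ge C_0$. Let $$\lambda_n=\lambda_{1,n}=2C\sqrt{\frac{\log n+2\log p+\log q}{n}},$$ let $\lambda_{2,n}\ge0$ with $n\,d_n^\star\,\lambda_{2,n}\to0$, and let $m_n\ge1$ be such that $m_0\le m_n$ and $m_n=o(\lambda_n^{-1})$. Then there is a deterministic sequence $r_n\to0$ such that, with probability tending to $1$ as $n\to\infty$, $$\frac1n\big\|\mathbf Z(\widehat{\mathbf\Theta}-\mathbf\Theta)\big\|_2^2\le 2M_\Phi\,\lambda_n\,m_n\max_{1\le j\le m_0+1}\Big\{\sum_{k=1}^p\big(d_{kj}+d_{k(j-1)}\big)\Big\}+r_n .$$ -/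

import Mathlib

open MeasureTheory ProbabilityTheory Filter Topology Asymptotics
open scoped Matrix Kronecker

namespace FusedVAR

noncomputable section

/-- Gaussian white noise with independent components: all the variables `ε t i`
(`t ∈ ℤ`, `i < p`) are independent standard normal. -/
structure IsGaussianWhiteNoise {Ω : Type*} [MeasurableSpace Ω] (P : Measure Ω) {p : ℕ}
    (ε : ℤ → Ω → Fin p → ℝ) : Prop where
  measurable : ∀ t, Measurable (ε t)
  law : ∀ t i, P.map (fun ω => ε t ω i) = gaussianReal 0 1
  indep : iIndepFun (fun (x : ℤ × Fin p) (ω : Ω) => ε x.1 ω x.2) P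

/-- The vector of regressors at time `t` for `q` lags, `(y_{t-1}', …, y_{t-q}')'`; the coordinate
`(l, c)` is the `c`-th component of `y_{t-(l+1)}`. -/
def lagVec {p : ℕ} (q : ℕ) (x : ℤ → Fin p → ℝ) (t : ℤ) : Fin q × Fin p → ℝ :=
  fun lc => x (t - 1 - (lc.1 : ℤ)) lc.2

/-- The positive semidefinite square root of a (covariance) matrix. -/
def psdSqrt {p : ℕ} (A : Matrix (Fin p) (Fin p) ℝ) : Matrix (Fin p) (Fin p) ℝ :=
  open scoped MatrixOrder in CFC.sqrt A

/-- `Y` is a stationary Gaussian time series, indexed by `ℤ`, that satisfies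
`Y_t = Φ^{(1)} Y_{t-1} + ⋯ + Φ^{(q)} Y_{t-q} + Σ^{1/2} ε_t`, where `Φ = (Φ^{(1)} … Φ^{(q)})`
and where, as always in an autoregression, the noise `ε_t` is independent of the past of `Y`. -/
structure IsStationaryGaussianVAR {Ω : Type*} [MeasurableSpace Ω] (P : Measure Ω) {p q : ℕ}
    (Φ : Matrix (Fin p) (Fin q × Fin p) ℝ) (Sig : Matrix (Fin p) (Fin p) ℝ)
    (ε Y : ℤ → Ω → Fin p → ℝ) : Prop where
  measurable : ∀ t, Measurable (Y t)
  gaussian : IsGaussianProcess Y P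
  stationary : ∀ h : ℤ, P.map (fun ω t => Y (t + h) ω) = P.map (fun ω t => Y t ω)
  recursion : ∀ t, ∀ᵐ ω ∂P,
    Y t ω = Φ *ᵥ lagVec q (fun s => Y s ω) t + psdSqrt Sig *ᵥ ε t ω
  causal : ∀ t : ℤ, IndepFun (fun ω (s : Set.Iio t) => Y s ω) (ε t) P

/-- The autocovariance matrices `Γ(h) = cov(Y_t, Y_{t+h})` of a stationary process. -/
def autocov {Ω : Type*} [MeasurableSpace Ω] (P : Measure Ω) {p : ℕ}
    (Y : ℤ → Ω → Fin p → ℝ) (h : ℤ) : Matrix (Fin p) (Fin p) ℝ :=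
  fun i k => covariance (fun ω => Y 0 ω i) (fun ω => Y h ω k) P

/-- The spectral density matrix `f(κ) = (2π)⁻¹ ∑_{l ∈ ℤ} Γ(l) e^{-iκl}`. -/
def spectralDensity {p : ℕ} (Γ : ℤ → Matrix (Fin p) (Fin p) ℝ) (κ : ℝ) :
    Matrix (Fin p) (Fin p) ℂ :=
  fun i k => (2 * (Real.pi : ℂ))⁻¹ *
    ∑' l : ℤ, (Γ l i k : ℂ) * Complex.exp (-(Complex.I * (κ : ℂ) * (l : ℂ)))

section

open scoped ComplexOrder

/-- The spectral density of `Γ` exists (the series converges absolutely), and for almost every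
`κ ∈ [-π, π]` all eigenvalues of the Hermitian matrix `f(κ)` lie in `[a, b]` (written in the
Loewner order: `a I ≤ f(κ) ≤ b I`). -/
structure SpectrumBetween {p : ℕ} (Γ : ℤ → Matrix (Fin p) (Fin p) ℝ) (a b : ℝ) : Prop where
  summable : ∀ i k, Summable fun l : ℤ => Γ l i k
  lower : ∀ᵐ κ ∂(volume.restrict (Set.Icc (-Real.pi) Real.pi)),
    (spectralDensity Γ κ - (a : ℂ) • (1 : Matrix (Fin p) (Fin p) ℂ)).PosSemidef
  upper : ∀ᵐ κ ∂(volume.restrict (Set.Icc (-Real.pi) Real.pi)),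
    ((b : ℂ) • (1 : Matrix (Fin p) (Fin p) ℂ) - spectralDensity Γ κ).PosSemidef

end

/-- The parameters of a `p`-dimensional VAR model of order `q` with `m0` break points
`0 = br 0 < br 1 < ⋯ < br m0 < br (m0 + 1) = T + 1`. For the segment `j ∈ {1, …, m0 + 1}`,
`Φ j` is the concatenated `p × pq` coefficient matrix `(Φ^{(1,j)} … Φ^{(q,j)})` and `Sig j` is the
covariance matrix of the noise (the values at other `j` play no role). -/
structure Model (p q T : ℕ) where
  m0 : ℕ
  br : ℕ → ℕ
  br_zero : br 0 = 0
  br_last : br (m0 + 1) = T + 1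
  br_lt : ∀ j ≤ m0, br j < br (j + 1)
  Φ : ℕ → Matrix (Fin p) (Fin q × Fin p) ℝ
  Sig : ℕ → Matrix (Fin p) (Fin p) ℝ
  Sig_psd : ∀ j, (Sig j).PosSemidef

namespace Model

variable {p q T : ℕ} (M : Model p q T)

/-- The segments `1, …, m0 + 1`. -/
def segments : Finset ℕ := Finset.Icc 1 (M.m0 + 1)

/-- `d_{kj}`: the number of nonzero entries in row `k` of `Φ j`, with `d_{k0} = 0`. -/
def d (k : Fin p) (j : ℕ) : ℕ :=
  if j = 0 then 0 else (Finset.univ.filter fun c : Fin q × Fin p => M.Φ j k c ≠ 0).card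

/-- The total sparsity `d* = ∑_j ∑_k d_{kj}`. -/
def dstar : ℕ := ∑ j ∈ M.segments, ∑ k, M.d k j

/-- `max_{1 ≤ j ≤ m0 + 1} ∑_k (d_{kj} + d_{k(j-1)})`. -/
def maxSparsity : ℕ := M.segments.sup fun j => ∑ k, (M.d k j + M.d k (j - 1))

/-- The index `j` of the segment `br (j - 1) ≤ t < br j` that contains the time `t`. -/
def seg (t : ℕ) : ℕ := 1 + ((Finset.Icc 1 M.m0).filter fun j => M.br j ≤ t).card

/-- The true parameter blocks. Block `i` (counted from `0`) belongs to the response time `q + i`: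
the first one is the coefficient matrix in force at time `q`, and every other one is the jump
`Φ (j + 1) - Φ j` if `q + i = br j` is a break point and `0` otherwise. -/
def theta {n : ℕ} (i : Fin n) : Matrix (Fin p) (Fin q × Fin p) ℝ :=
  if (i : ℕ) = 0 then M.Φ (M.seg q) else M.Φ (M.seg (q + i)) - M.Φ (M.seg (q + i - 1))

/-- `y` follows the model: it coincides with the stationary process `Y 1` of the first segment up
to the first break point, and it satisfies the autoregressive recursion of segment `j` at all times
`br (j - 1) ≤ t < br j` (so that the recursion runs across the break points). -/
structure IsPath {Ω : Type*} [MeasurableSpace Ω] (P : Measure Ω)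
    (ε : ℤ → Ω → Fin p → ℝ) (Y : ℕ → ℤ → Ω → Fin p → ℝ) (y : ℤ → Ω → Fin p → ℝ) : Prop where
  init : ∀ t : ℤ, t < M.br 1 → y t =ᵐ[P] Y 1 t
  recursion : ∀ j ∈ M.segments, ∀ t : ℤ, (M.br (j - 1) : ℤ) ≤ t → t < M.br j → ∀ᵐ ω ∂P,
    y t ω = M.Φ j *ᵥ lagVec q (fun s => y s ω) t + psdSqrt (M.Sig j) *ᵥ ε t ω

end Model

/-- The response matrix `𝒴`, with rows `y_q', …, y_T'`, `T = n + q - 1`. -/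
def responseMatrix {p : ℕ} (n q : ℕ) (x : ℤ → Fin p → ℝ) : Matrix (Fin n) (Fin p) ℝ :=
  fun r k => x ((q : ℤ) + (r : ℤ)) k

/-- The block lower triangular design matrix `𝒳`: row `r` belongs to the time `q + r`, and it has
the regressors of that time in each of the block columns `0, …, r`. -/
def designMatrix {p : ℕ} (n q : ℕ) (x : ℤ → Fin p → ℝ) :
    Matrix (Fin n) (Fin n × (Fin q × Fin p)) ℝ :=
  fun r ic => if ic.1 ≤ r then lagVec q x ((q : ℤ) + (r : ℤ)) ic.2 else 0

/-- `𝐙 = I_p ⊗ 𝒳`. -/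
def bigZ {p : ℕ} (n q : ℕ) (x : ℤ → Fin p → ℝ) :
    Matrix (Fin p × Fin n) (Fin p × (Fin n × (Fin q × Fin p))) ℝ :=
  (1 : Matrix (Fin p) (Fin p) ℝ) ⊗ₖ designMatrix n q x

/-- `𝐘 = vec 𝒴`. -/
def bigY {p : ℕ} (n q : ℕ) (x : ℤ → Fin p → ℝ) : Fin p × Fin n → ℝ :=
  (responseMatrix n q x).vec

/-- The vectorization of the matrix with the block rows `θ_1', …, θ_n'`. -/
def bigTheta {p n q : ℕ} (θ : Fin n → Matrix (Fin p) (Fin q × Fin p) ℝ) :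
    Fin p × (Fin n × (Fin q × Fin p)) → ℝ :=
  Matrix.vec (Matrix.of fun (ic : Fin n × (Fin q × Fin p)) (k : Fin p) => θ ic.1 k ic.2)

/-- The squared Euclidean norm. -/
def sqNorm {ι : Type*} [Fintype ι] (v : ι → ℝ) : ℝ := ∑ i, v i ^ 2

/-- The entrywise `ℓ₁` norm of a matrix. -/
def l1Norm {ι κ : Type*} [Fintype ι] [Fintype κ] (A : Matrix ι κ ℝ) : ℝ := ∑ i, ∑ k, |A i k|

/-- The fused lasso objective
`n⁻¹ ‖𝐘 - 𝐙 Θ‖₂² + λ₁ ‖Θ‖₁ + λ₂ ∑_k ‖∑_{j ≤ k} θ_j‖₁`. -/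
def objective {p : ℕ} (n q : ℕ) (lam1 lam2 : ℝ) (x : ℤ → Fin p → ℝ)
    (θ : Fin n → Matrix (Fin p) (Fin q × Fin p) ℝ) : ℝ :=
  (1 / (n : ℝ)) * sqNorm (bigY n q x - bigZ n q x *ᵥ bigTheta θ)
    + lam1 * ∑ i, l1Norm (θ i)
    + lam2 * ∑ k, l1Norm (∑ j ∈ Finset.Iic k, θ j)

/-- `θ` is a fused lasso estimate: a minimizer of the objective. -/
def IsFusedLasso {p : ℕ} (n q : ℕ) (lam1 lam2 : ℝ) (x : ℤ → Fin p → ℝ)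
    (θ : Fin n → Matrix (Fin p) (Fin q × Fin p) ℝ) : Prop :=
  ∀ θ' : Fin n → Matrix (Fin p) (Fin q × Fin p) ℝ,
    objective n q lam1 lam2 x θ ≤ objective n q lam1 lam2 x θ'

/-- The prediction error `n⁻¹ ‖𝐙 (Θ̂ - Θ)‖₂²`. -/
def predictionError {p : ℕ} (n q : ℕ) (x : ℤ → Fin p → ℝ)
    (θhat θ : Fin n → Matrix (Fin p) (Fin q × Fin p) ℝ) : ℝ :=
  (1 / (n : ℝ)) * sqNorm (bigZ n q x *ᵥ (bigTheta θhat - bigTheta θ))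

/-- The tuning parameter `λ₁ = 2 C √((log n + 2 log p + log q) / n)`. -/
def lambda1 (C : ℝ) (n p q : ℕ) : ℝ :=
  2 * C * Real.sqrt ((Real.log n + 2 * Real.log p + Real.log q) / n)

/-- Stationarity assumption: in every segment `j` the process `Y j` is a stationary Gaussian
autoregression with the parameters of the segment, and the eigenvalues of its spectral density
lie in `[a, b]`. -/
def StationaritySpectrum {p q T : ℕ} (M : Model p q T) {Ω : Type*} [MeasurableSpace Ω]
    (P : Measure Ω) (ε : ℤ → Ω → Fin p → ℝ) (Y : ℕ → ℤ → Ω → Fin p → ℝ) (a b : ℝ) : Prop :=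
  ∀ j ∈ M.segments, IsStationaryGaussianVAR P (M.Φ j) (M.Sig j) ε (Y j) ∧
    SpectrumBetween (autocov P (Y j)) a b

end

end FusedVAR

open FusedVAR

/-!
The proof has a deterministic and a probabilistic part.

*Deterministic part.* Compare the minimizer with the midpoint between itself and the true parameter
`θ`. The quadratic loss is strongly convex along the prediction, so that this gains half of the
prediction error (`IsFusedLasso.objective_add_le`). On the event that all coordinates of the score
`Z'(Y - Zθ) / n` are at most `λ₁ / 4`, the cross term is absorbed by the penalty, and the prediction
error is at most `λ₁ ∑ ‖θ_i‖₁ + λ₂ ∑_k ‖∑_{j ≤ k} θ_j‖₁` (`predictionError_le_of_score`). The true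
parameter has at most `m₀ + 1 ≤ 2 m` nonzero blocks, each of them a coefficient matrix or a
difference of two consecutive ones, which bounds the first sum by `2 m MΦ maxSparsity`. Its partial
sums are the coefficient matrices of the segments, so that the second term is at most
`MΦ λ₂ n d⋆`, the remainder `r n`.

*The score.* Its coordinates are sums `∑ x_t η_t`, where `x_t` is a component of the past of the
observed process and `η_t` a component of the Gaussian innovation. The exponential
martingale of such a sum (`lintegral_exp_martingale`) gives a subgaussian deviation inequality
on the event that the quadratic variation `∑ var(η_t) x_t²` is of order `n`
(`measure_sum_mul_noise_ge_le`), and a union bound over the `n p² q` coordinates is affordable for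
`λ₁` with a constant `C` that depends on `a`, `b` and `q` only.

*The quadratic variation.* The observed process is not stationary. However, the spectral density
of the first segment is bounded away from zero, so `Σ₁` is invertible, the noise
is a linear functional of the first stationary process, and by the recursion so is the observed
process (`Model.IsPath.linPast`). It is therefore a centered Gaussian process, and
`E exp(∑ y_t² / (4K)) ≤ √2 ^ N` as soon as all linear functionals satisfy
`var(∑ g_t y_t) ≤ K ∑ g_t²` (`lintegral_exp_sum_sq_le`). The resulting exceptional probability
`p exp(-n)` is negligible because `m = o(1 / λ₁)` and `m ≥ 1` force `λ₁ ≤ 2 C` eventually, hence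
`log p ≤ n / 2`.

*The covariance operator.* Let `G_j(w)` be the variance of the functional `w` of `q` consecutive
observations of the `j`-th stationary process. The spectral bounds give `2πa |w|² ≤ G_j ≤ 2πb |w|²`,
and applied to `2q` consecutive observations they show that `q` of them cannot be predicted from the
`q` preceding ones with a variance below `2πa |w|²`. Hence `q` steps of the dual recursion contract
`G_j` by the factor `1 - a/b` (`lagForm_iterate_le`), and a weighted sum of `G_j` over `q` steps is a
Lyapunov form that every single step contracts. Running the recursion forward in time, the variance
of `∑_{s < t} g_s y_s` plus a functional `w` of the regressors at time `t` stays below a constant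
multiple of the Lyapunov form of the current segment, plus a constant times `∑ g_s²`
(`segment_bound`). At a break point the form changes, which costs a constant factor; the excess
over the stationary level decays geometrically, and so it is gone by the next break point when the
segments are long (`multisegment_bound`). This is where the spacing condition enters.
-/

namespace FusedVAR

open IsStationaryGaussianVAR

/-! ### The spectral density and the variance of finite linear combinations -/

lemma integrable_cexp_freq (h : ℤ) :
    Integrable (fun κ : ℝ => Complex.exp (Complex.I * κ * h))
      (volume.restrict (Set.Icc (-Real.pi) Real.pi)) :=
  (Continuous.continuousOn (by fun_prop)).integrableOn_compact isCompact_Icc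

lemma norm_cexp_freq (κ : ℝ) (h : ℤ) : ‖Complex.exp (Complex.I * κ * h)‖ = 1 := by
  rw [Complex.norm_exp]
  simp

lemma integral_cexp_freq (h : ℤ) :
    ∫ κ in Set.Icc (-Real.pi) Real.pi, Complex.exp (Complex.I * κ * h)
      = if h = 0 then (2 * Real.pi : ℂ) else 0 := by
  have hle : -Real.pi ≤ Real.pi := by linarith [Real.pi_pos]
  rw [integral_Icc_eq_integral_Ioc, ← intervalIntegral.integral_of_le hle]
  split_ifs with h0
  · subst h0
    simp
    ring
  · have hc : (Complex.I * h : ℂ) ≠ 0 := mul_ne_zero Complex.I_ne_zero (by exact_mod_cast h0)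
    have := integral_exp_mul_complex (a := -Real.pi) (b := Real.pi) hc
    have h2 : ∀ κ : ℝ, Complex.I * κ * h = Complex.I * h * κ := fun κ => by ring
    simp_rw [h2]
    rw [this]
    have h3 : Complex.exp (Complex.I * h * (Real.pi : ℝ))
        = Complex.exp (Complex.I * h * ((-Real.pi : ℝ) : ℂ)) := by
      rw [Complex.exp_eq_exp_iff_exists_int]
      refine ⟨h, ?_⟩
      push_cast
      ring
    rw [h3, sub_self, zero_div]

/-- Fourier inversion: the autocovariances are the Fourier coefficients of the spectral density. -/
lemma integral_spectralDensity {p : ℕ} {Γ : ℤ → Matrix (Fin p) (Fin p) ℝ} {i k : Fin p}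
    (hs : Summable fun l : ℤ => Γ l i k) (h : ℤ) :
    Integrable (fun κ : ℝ => Complex.exp (Complex.I * κ * h) * spectralDensity Γ κ i k)
        (volume.restrict (Set.Icc (-Real.pi) Real.pi)) ∧
      ∫ κ in Set.Icc (-Real.pi) Real.pi, Complex.exp (Complex.I * κ * h) * spectralDensity Γ κ i k
        = (Γ h i k : ℂ) := by
  set μ := volume.restrict (Set.Icc (-Real.pi) Real.pi) with hμ
  let F : ℤ → ℝ → ℂ := fun l κ => (2 * (Real.pi : ℂ))⁻¹ * (Γ l i k : ℂ) *
    Complex.exp (Complex.I * κ * ((h - l : ℤ) : ℂ))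
  have hF : ∀ κ : ℝ, Complex.exp (Complex.I * κ * h) * spectralDensity Γ κ i k = ∑' l, F l κ := by
    intro κ
    simp only [spectralDensity, F, ← tsum_mul_left]
    refine tsum_congr fun l => ?_
    push_cast
    rw [mul_sub, sub_eq_add_neg, Complex.exp_add]
    ring
  have hFi : ∀ l, Integrable (F l) μ := fun l => (integrable_cexp_freq _).const_mul _
  have hn : ∀ l, ∫ κ, ‖F l κ‖ ∂μ = |Γ l i k| := by
    intro l
    have : ∀ κ, ‖F l κ‖ = (2 * Real.pi)⁻¹ * |Γ l i k| := by
      intro κ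
      simp only [F, norm_mul, norm_cexp_freq, norm_inv, Complex.norm_real, Real.norm_eq_abs,
        abs_of_pos Real.pi_pos, mul_one]
      simp
    simp only [this, integral_const, smul_eq_mul, hμ]
    rw [measureReal_restrict_apply_univ, Real.volume_real_Icc_of_le (by linarith [Real.pi_pos])]
    have := Real.pi_pos
    field_simp
    ring
  have hsum : Summable fun l => ∫ κ, ‖F l κ‖ ∂μ := by
    simp_rw [hn]
    exact hs.abs
  have hint := hasSum_integral_of_summable_integral_norm hFi hsum
  have hval : ∀ l, ∫ κ, F l κ ∂μ = if l = h then (Γ h i k : ℂ) else 0 := by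
    intro l
    simp only [F, integral_const_mul, hμ, integral_cexp_freq, sub_eq_zero, eq_comm (a := h)]
    split_ifs with hl
    · subst hl
      have : (Real.pi : ℂ) ≠ 0 := by exact_mod_cast Real.pi_ne_zero
      field_simp
    · simp
  refine ⟨?_, ?_⟩
  · simp_rw [hF]
    have hb : ∀ κ, Summable fun l => F l κ := by
      intro κ
      refine Summable.of_norm_bounded (g := fun l => (2 * Real.pi)⁻¹ * |Γ l i k|)
        (hs.abs.mul_left _) fun l => ?_
      simp only [F, norm_mul, norm_cexp_freq, norm_inv, Complex.norm_real, Real.norm_eq_abs,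
        abs_of_pos Real.pi_pos, mul_one]
      simp
    have hcont : Continuous fun κ => ∑' l, F l κ := by
      refine continuous_tsum (u := fun l => (2 * Real.pi)⁻¹ * |Γ l i k|) (fun l => ?_)
        (hs.abs.mul_left _) fun l κ => ?_
      · simp only [F]
        fun_prop
      · simp only [F, norm_mul, norm_cexp_freq, norm_inv, Complex.norm_real, Real.norm_eq_abs,
          abs_of_pos Real.pi_pos, mul_one]
        simp
    exact hcont.continuousOn.integrableOn_compact isCompact_Icc
  · simp_rw [hF]
    rw [← hint.tsum_eq]
    simp_rw [hval]
    simp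

/-- The quadratic form in the autocovariances that gives the variance of `∑_{t ∈ S} v_t ⬝ Y_t`. -/
noncomputable def autocovForm {p : ℕ} (Γ : ℤ → Matrix (Fin p) (Fin p) ℝ) (S : Finset ℤ)
    (v : ℤ → Fin p → ℝ) : ℝ :=
  ∑ s ∈ S, ∑ t ∈ S, ∑ i, ∑ k, v s i * v t k * Γ (t - s) i k

/-- The trigonometric vector polynomial `∑_{t ∈ S} e^{iκt} v_t`. -/
noncomputable def trigVec {p : ℕ} (S : Finset ℤ) (v : ℤ → Fin p → ℝ) (κ : ℝ) : Fin p → ℂ :=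
  fun i => ∑ t ∈ S, (v t i : ℂ) * Complex.exp (Complex.I * κ * t)

lemma star_trigVec_mul {p : ℕ} (S : Finset ℤ) (v : ℤ → Fin p → ℝ) (κ : ℝ) (i k : Fin p) :
    star (trigVec S v κ i) * trigVec S v κ k
      = ∑ s ∈ S, ∑ t ∈ S, ((v s i * v t k : ℝ) : ℂ) *
          Complex.exp (Complex.I * κ * ((t - s : ℤ) : ℂ)) := by
  simp only [trigVec, star_sum, Finset.sum_mul_sum]
  refine Finset.sum_congr rfl fun s _ => Finset.sum_congr rfl fun t _ => ?_
  have : star (Complex.exp (Complex.I * κ * s)) = Complex.exp (-(Complex.I * κ * s)) := by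
    rw [Complex.star_def, ← Complex.exp_conj]
    simp
  rw [star_mul', this]
  push_cast
  rw [mul_sub, sub_eq_neg_add, Complex.exp_add]
  simp
  ring

lemma integral_form_spectralDensity {p : ℕ} {Γ : ℤ → Matrix (Fin p) (Fin p) ℝ}
    (hs : ∀ i k, Summable fun l : ℤ => Γ l i k) (S : Finset ℤ) (v : ℤ → Fin p → ℝ) :
    Integrable (fun κ : ℝ => star (trigVec S v κ) ⬝ᵥ (spectralDensity Γ κ *ᵥ trigVec S v κ))
        (volume.restrict (Set.Icc (-Real.pi) Real.pi)) ∧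
    ∫ κ in Set.Icc (-Real.pi) Real.pi,
      star (trigVec S v κ) ⬝ᵥ (spectralDensity Γ κ *ᵥ trigVec S v κ)
      = ((autocovForm Γ S v : ℝ) : ℂ) := by
  have hexp : ∀ κ : ℝ, star (trigVec S v κ) ⬝ᵥ (spectralDensity Γ κ *ᵥ trigVec S v κ)
      = ∑ i, ∑ k, ∑ s ∈ S, ∑ t ∈ S, ((v s i * v t k : ℝ) : ℂ) *
          (Complex.exp (Complex.I * κ * ((t - s : ℤ) : ℂ)) * spectralDensity Γ κ i k) := by
    intro κ
    simp only [dotProduct, Matrix.mulVec, Finset.mul_sum, Pi.star_apply]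
    refine Finset.sum_congr rfl fun i _ => Finset.sum_congr rfl fun k _ => ?_
    rw [show star (trigVec S v κ i) * (spectralDensity Γ κ i k * trigVec S v κ k)
      = star (trigVec S v κ i) * trigVec S v κ k * spectralDensity Γ κ i k by ring,
      star_trigVec_mul, Finset.sum_mul]
    refine Finset.sum_congr rfl fun s _ => ?_
    rw [Finset.sum_mul]
    refine Finset.sum_congr rfl fun t _ => ?_
    ring
  have hI : ∀ (i k : Fin p) (s t : ℤ), Integrable (fun κ : ℝ => ((v s i * v t k : ℝ) : ℂ) *
      (Complex.exp (Complex.I * κ * ((t - s : ℤ) : ℂ)) * spectralDensity Γ κ i k))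
      (volume.restrict (Set.Icc (-Real.pi) Real.pi)) := fun i k s t =>
    ((integral_spectralDensity (hs i k) (t - s)).1).const_mul _
  simp_rw [hexp]
  refine ⟨?_, ?_⟩
  · exact integrable_finsetSum _ fun i _ => integrable_finsetSum _ fun k _ =>
      integrable_finsetSum _ fun s _ => integrable_finsetSum _ fun t _ => hI i k s t
  · rw [integral_finsetSum _ fun i _ => integrable_finsetSum _ fun k _ =>
      integrable_finsetSum _ fun s _ => integrable_finsetSum _ fun t _ => hI i k s t]
    have : ∀ i : Fin p, ∫ κ in Set.Icc (-Real.pi) Real.pi, ∑ k, ∑ s ∈ S, ∑ t ∈ S,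
        ((v s i * v t k : ℝ) : ℂ) *
          (Complex.exp (Complex.I * κ * ((t - s : ℤ) : ℂ)) * spectralDensity Γ κ i k)
        = ∑ k, ∑ s ∈ S, ∑ t ∈ S, ((v s i * v t k * Γ (t - s) i k : ℝ) : ℂ) := by
      intro i
      rw [integral_finsetSum _ fun k _ =>
        integrable_finsetSum _ fun s _ => integrable_finsetSum _ fun t _ => hI i k s t]
      refine Finset.sum_congr rfl fun k _ => ?_
      rw [integral_finsetSum _ fun s _ => integrable_finsetSum _ fun t _ => hI i k s t]
      refine Finset.sum_congr rfl fun s _ => ?_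
      rw [integral_finsetSum _ fun t _ => hI i k s t]
      refine Finset.sum_congr rfl fun t _ => ?_
      rw [integral_const_mul, (integral_spectralDensity (hs i k) (t - s)).2]
      push_cast
      ring
    simp_rw [this, autocovForm]
    push_cast
    rw [Finset.sum_congr rfl fun i _ => Finset.sum_comm, Finset.sum_comm]
    refine Finset.sum_congr rfl fun s _ => ?_
    rw [Finset.sum_congr rfl fun i _ => Finset.sum_comm, Finset.sum_comm]

lemma integral_star_trigVec {p : ℕ} (S : Finset ℤ) (v : ℤ → Fin p → ℝ) :
    Integrable (fun κ : ℝ => star (trigVec S v κ) ⬝ᵥ trigVec S v κ)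
        (volume.restrict (Set.Icc (-Real.pi) Real.pi)) ∧
    ∫ κ in Set.Icc (-Real.pi) Real.pi, star (trigVec S v κ) ⬝ᵥ trigVec S v κ
      = ((2 * Real.pi * ∑ t ∈ S, sqNorm (v t) : ℝ) : ℂ) := by
  have hexp : ∀ κ : ℝ, star (trigVec S v κ) ⬝ᵥ trigVec S v κ
      = ∑ i, ∑ s ∈ S, ∑ t ∈ S, ((v s i * v t i : ℝ) : ℂ) *
          Complex.exp (Complex.I * κ * ((t - s : ℤ) : ℂ)) := by
    intro κ
    simp only [dotProduct, Pi.star_apply, star_trigVec_mul]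
  have hI : ∀ (i : Fin p) (s t : ℤ), Integrable (fun κ : ℝ => ((v s i * v t i : ℝ) : ℂ) *
      Complex.exp (Complex.I * κ * ((t - s : ℤ) : ℂ)))
      (volume.restrict (Set.Icc (-Real.pi) Real.pi)) := fun i s t =>
    (integrable_cexp_freq (t - s)).const_mul _
  simp_rw [hexp]
  refine ⟨integrable_finsetSum _ fun i _ =>
      integrable_finsetSum _ fun s _ => integrable_finsetSum _ fun t _ => hI i s t, ?_⟩
  rw [integral_finsetSum _ fun i _ =>
      integrable_finsetSum _ fun s _ => integrable_finsetSum _ fun t _ => hI i s t]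
  have : ∀ i : Fin p, ∫ κ in Set.Icc (-Real.pi) Real.pi, ∑ s ∈ S, ∑ t ∈ S,
      ((v s i * v t i : ℝ) : ℂ) * Complex.exp (Complex.I * κ * ((t - s : ℤ) : ℂ))
      = ∑ s ∈ S, ((2 * Real.pi * v s i ^ 2 : ℝ) : ℂ) := by
    intro i
    rw [integral_finsetSum _ fun s _ => integrable_finsetSum _ fun t _ => hI i s t]
    refine Finset.sum_congr rfl fun s hs => ?_
    rw [integral_finsetSum _ fun t _ => hI i s t]
    simp_rw [integral_const_mul, integral_cexp_freq, sub_eq_zero]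
    simp only [mul_ite, mul_zero, Finset.sum_ite_eq', hs, if_true]
    push_cast
    ring
  simp_rw [this, sqNorm]
  push_cast
  rw [Finset.sum_comm, Finset.mul_sum]
  simp_rw [Finset.mul_sum]

section

open scoped ComplexOrder

/-- Bounds on the eigenvalues of the spectral density bound all finite sections of the covariance
operator. -/
lemma SpectrumBetween.autocovForm_bounds {p : ℕ} {Γ : ℤ → Matrix (Fin p) (Fin p) ℝ} {a b : ℝ}
    (h : SpectrumBetween Γ a b) (S : Finset ℤ) (v : ℤ → Fin p → ℝ) :
    2 * Real.pi * a * ∑ t ∈ S, sqNorm (v t) ≤ autocovForm Γ S v ∧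
      autocovForm Γ S v ≤ 2 * Real.pi * b * ∑ t ∈ S, sqNorm (v t) := by
  obtain ⟨hq, hqv⟩ := integral_form_spectralDensity h.summable S v
  obtain ⟨hx, hxv⟩ := integral_star_trigVec S v
  set μ := volume.restrict (Set.Icc (-Real.pi) Real.pi) with hμ
  have key : ∀ c : ℝ, ∫ κ, (star (trigVec S v κ) ⬝ᵥ (spectralDensity Γ κ *ᵥ trigVec S v κ)
      - c * (star (trigVec S v κ) ⬝ᵥ trigVec S v κ)).re ∂μ
      = autocovForm Γ S v - 2 * Real.pi * c * ∑ t ∈ S, sqNorm (v t) := by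
    intro c
    have hi := hq.sub (hx.const_mul (c : ℂ))
    have h1 : ∫ κ, (star (trigVec S v κ) ⬝ᵥ (spectralDensity Γ κ *ᵥ trigVec S v κ)
        - c * (star (trigVec S v κ) ⬝ᵥ trigVec S v κ)).re ∂μ
        = (∫ κ, (star (trigVec S v κ) ⬝ᵥ (spectralDensity Γ κ *ᵥ trigVec S v κ)
        - c * (star (trigVec S v κ) ⬝ᵥ trigVec S v κ)) ∂μ).re := integral_re hi
    rw [h1, integral_sub hq (hx.const_mul _), integral_const_mul, hqv, hxv]
    simp only [Complex.sub_re, Complex.ofReal_re, ← Complex.ofReal_mul]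
    ring
  constructor
  · have : 0 ≤ ∫ κ, (star (trigVec S v κ) ⬝ᵥ (spectralDensity Γ κ *ᵥ trigVec S v κ)
        - a * (star (trigVec S v κ) ⬝ᵥ trigVec S v κ)).re ∂μ := by
      refine integral_nonneg_of_ae ?_
      filter_upwards [h.lower] with κ hκ
      have := (Complex.le_def.1 (hκ.dotProduct_mulVec_nonneg (trigVec S v κ))).1
      simpa [Matrix.sub_mulVec, Matrix.smul_mulVec, dotProduct_sub, dotProduct_smul] using this
    rw [key] at this
    linarith
  · have : ∫ κ, (star (trigVec S v κ) ⬝ᵥ (spectralDensity Γ κ *ᵥ trigVec S v κ)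
        - b * (star (trigVec S v κ) ⬝ᵥ trigVec S v κ)).re ∂μ ≤ 0 := by
      refine integral_nonpos_of_ae ?_
      filter_upwards [h.upper] with κ hκ
      have := (Complex.le_def.1 (hκ.dotProduct_mulVec_nonneg (trigVec S v κ))).1
      simpa [Matrix.sub_mulVec, Matrix.smul_mulVec, dotProduct_sub, dotProduct_smul] using this
    rw [key] at this
    linarith

end

/-! ### Linear functionals of the past -/

section Past

variable {Ω : Type*} {p : ℕ} {Y : ℤ → Ω → Fin p → ℝ}

/-- Finite linear combinations of the components of `Y s`, `s < t`. -/
def pastSpan (Y : ℤ → Ω → Fin p → ℝ) (t : ℤ) : Submodule ℝ (Ω → ℝ) :=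
  Submodule.span ℝ {h | ∃ s < t, ∃ c, h = fun ω => Y s ω c}

/-- The `σ`-algebra generated by `Y s`, `s < t`. -/
abbrev pastSigma (Y : ℤ → Ω → Fin p → ℝ) (t : ℤ) : MeasurableSpace Ω :=
  MeasurableSpace.comap (fun ω (s : Set.Iio t) => Y s ω) inferInstance

lemma pastSpan_mono {s t : ℤ} (h : s ≤ t) : pastSpan Y s ≤ pastSpan Y t :=
  Submodule.span_mono fun _ ⟨r, hr, c, hc⟩ => ⟨r, hr.trans_le h, c, hc⟩

lemma measurable_of_mem_pastSpan {t : ℤ} {f : Ω → ℝ} (hf : f ∈ pastSpan Y t) :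
    Measurable[pastSigma Y t] f := by
  induction hf using Submodule.span_induction with
  | mem f hf =>
    obtain ⟨s, hs, c, rfl⟩ := hf
    have h1 : Measurable[pastSigma Y t] (fun ω (s : Set.Iio t) => Y s ω) :=
      comap_measurable _
    have h2 : Measurable (fun z : Set.Iio t → Fin p → ℝ => z ⟨s, hs⟩ c) := by fun_prop
    exact h2.comp h1
  | zero => exact measurable_const
  | add f g _ _ hf hg => exact hf.add hg
  | smul c f _ hf => exact hf.const_smul c

variable [mΩ : MeasurableSpace Ω] {P : Measure Ω}

/-- `f` is almost surely a finite linear combination of the components of `Y s`, `s < t`. -/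
def LinPast (P : Measure Ω) (Y : ℤ → Ω → Fin p → ℝ) (t : ℤ) (f : Ω → ℝ) : Prop :=
  ∃ g ∈ pastSpan Y t, f =ᵐ[P] g

lemma LinPast.of_lt {s t : ℤ} (h : s < t) (c : Fin p) : LinPast P Y t (fun ω => Y s ω c) :=
  ⟨_, Submodule.subset_span ⟨s, h, c, rfl⟩, ae_eq_rfl⟩

lemma LinPast.congr {t : ℤ} {f g : Ω → ℝ} (hf : LinPast P Y t f) (h : g =ᵐ[P] f) :
    LinPast P Y t g := by
  obtain ⟨u, hu, hfu⟩ := hf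
  exact ⟨u, hu, h.trans hfu⟩

lemma LinPast.zero (t : ℤ) : LinPast P Y t (fun _ => 0) :=
  ⟨0, Submodule.zero_mem _, ae_eq_rfl⟩

lemma LinPast.add {t : ℤ} {f g : Ω → ℝ} (hf : LinPast P Y t f) (hg : LinPast P Y t g) :
    LinPast P Y t (fun ω => f ω + g ω) := by
  obtain ⟨u, hu, hfu⟩ := hf
  obtain ⟨v, hv, hgv⟩ := hg
  exact ⟨u + v, Submodule.add_mem _ hu hv, hfu.add hgv⟩

lemma LinPast.const_mul {t : ℤ} {f : Ω → ℝ} (hf : LinPast P Y t f) (c : ℝ) :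
    LinPast P Y t (fun ω => c * f ω) := by
  obtain ⟨u, hu, hfu⟩ := hf
  refine ⟨c • u, Submodule.smul_mem _ c hu, ?_⟩
  filter_upwards [hfu] with ω hω
  simp [hω]

lemma LinPast.sub {t : ℤ} {f g : Ω → ℝ} (hf : LinPast P Y t f) (hg : LinPast P Y t g) :
    LinPast P Y t (fun ω => f ω - g ω) := by
  refine (hf.add (hg.const_mul (-1))).congr (ae_of_all _ fun ω => ?_)
  ring

lemma LinPast.sum {ι : Type*} {t : ℤ} (s : Finset ι) {f : ι → Ω → ℝ}
    (hf : ∀ i ∈ s, LinPast P Y t (f i)) : LinPast P Y t (fun ω => ∑ i ∈ s, f i ω) := by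
  classical
  induction s using Finset.induction_on with
  | empty => simpa using LinPast.zero t
  | insert i s hi ih =>
    simp only [Finset.sum_insert hi]
    exact (hf i (Finset.mem_insert_self i s)).add
      (ih fun j hj => hf j (Finset.mem_insert_of_mem hj))

lemma LinPast.dotProduct {ι : Type*} [Fintype ι] {t : ℤ} (w : ι → ℝ) {f : Ω → ι → ℝ}
    (hf : ∀ i, LinPast P Y t (fun ω => f ω i)) : LinPast P Y t (fun ω => w ⬝ᵥ f ω) :=
  LinPast.sum _ fun i _ => (hf i).const_mul (w i)

lemma LinPast.mono {s t : ℤ} {f : Ω → ℝ} (hf : LinPast P Y s f) (h : s ≤ t) :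
    LinPast P Y t f := by
  obtain ⟨u, hu, hfu⟩ := hf
  exact ⟨u, pastSpan_mono h hu, hfu⟩

lemma LinPast.aestronglyMeasurable {t : ℤ} {f : Ω → ℝ} (hf : LinPast P Y t f) :
    AEStronglyMeasurable[pastSigma Y t] f P := by
  obtain ⟨u, hu, hfu⟩ := hf
  exact ⟨u, (measurable_of_mem_pastSpan hu).stronglyMeasurable, hfu⟩

lemma pastSigma_le (hY : ∀ t, Measurable (Y t)) (t : ℤ) : pastSigma Y t ≤ mΩ :=
  (measurable_pi_lambda _ fun s : Set.Iio t => hY s).comap_le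

/-- A linear functional of the past of a Gaussian process is Gaussian. -/
lemma LinPast.hasGaussianLaw (hY : IsGaussianProcess Y P) {t : ℤ} {f : Ω → ℝ}
    (hf : LinPast P Y t f) : HasGaussianLaw f P := by
  obtain ⟨g, hg, hfg⟩ := hf
  refine HasGaussianLaw.congr ?_ hfg.symm
  let X : ℤ × Fin p → Ω → ℝ := fun x ω => Y x.1 ω x.2
  have hX : IsGaussianProcess X P := hY.of_isGaussianProcess fun x =>
    ⟨{x.1}, (ContinuousLinearMap.proj (R := ℝ) (φ := fun _ : Fin p => ℝ) x.2).comp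
      (ContinuousLinearMap.proj (R := ℝ) (φ := fun _ : ({x.1} : Finset ℤ) => Fin p → ℝ)
        ⟨x.1, Finset.mem_singleton_self _⟩), fun ω => rfl⟩
  have hg' : g ∈ Submodule.span ℝ (Set.range X) := by
    refine Submodule.span_mono ?_ hg
    rintro _ ⟨s, -, c, rfl⟩
    exact ⟨(s, c), rfl⟩
  obtain ⟨v, rfl⟩ := Finsupp.mem_span_range_iff_exists_finsupp.1 hg'
  have hZ : IsGaussianProcess (fun x => v x • X x) P := hX.smul v
  exact hZ.hasGaussianLaw_sum

end Past

/-! ### Gaussian noise -/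

section Noise

variable {Ω : Type*} [mΩ : MeasurableSpace Ω] {P : Measure Ω} {p : ℕ}
  {ε : ℤ → Ω → Fin p → ℝ}

lemma IsGaussianWhiteNoise.hasLaw_dotProduct (hε : IsGaussianWhiteNoise P ε) (t : ℤ)
    (c : Fin p → ℝ) :
    P.map (fun ω => c ⬝ᵥ ε t ω) = gaussianReal 0 (sqNorm c).toNNReal := by
  have hlaw : ∀ i, HasGaussianLaw (fun ω => ε t ω i) P := fun i =>
    ⟨by rw [hε.law]; infer_instance⟩
  have hind : iIndepFun (fun i ω => ε t ω i) P :=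
    hε.indep.precomp (g := fun i : Fin p => (t, i)) fun i j hij => by simpa using hij
  have hmean : ∀ i, ∫ ω, ε t ω i ∂P = 0 := fun i => by
    rw [← integral_map (φ := fun ω => ε t ω i) (f := fun x => x) (hlaw i).aemeasurable
      measurable_id.aestronglyMeasurable, hε.law, integral_id_gaussianReal]
  have hvar : ∀ i, Var[fun ω => ε t ω i; P] = 1 := fun i => by
    rw [← variance_id_map (hlaw i).aemeasurable, hε.law, variance_id_gaussianReal]
    simp
  have hG : HasGaussianLaw (fun ω => c ⬝ᵥ ε t ω) P := by
    have := iIndepFun.hasGaussianLaw hlaw hind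
    exact this.map_fun (∑ i, c i • ContinuousLinearMap.proj (R := ℝ) (φ := fun _ : Fin p => ℝ) i)
      |>.congr (ae_of_all _ fun ω => by simp [dotProduct])
  rw [hG.map_eq_gaussianReal]
  congr 1
  · simp only [dotProduct]
    rw [integral_finsetSum _ fun i _ => (hlaw i).integrable.const_mul _]
    simp [integral_const_mul, hmean]
  · congr 1
    have h2 : (fun ω => c ⬝ᵥ ε t ω) = ∑ i, fun ω => c i * ε t ω i := by
      ext ω
      simp [dotProduct]
    rw [h2, IndepFun.variance_sum (fun i _ => (hlaw i).memLp_two.const_mul _)]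
    · simp [variance_const_mul, hvar, sqNorm]
    · intro i _ j _ hij
      exact (hind.indepFun hij).comp (φ := fun x => c i * x) (ψ := fun x => c j * x)
        (by fun_prop) (by fun_prop)

lemma psdSqrt_mul_self {A : Matrix (Fin p) (Fin p) ℝ} (hA : A.PosSemidef) :
    psdSqrt A * psdSqrt A = A := by
  open scoped MatrixOrder in
  exact CFC.sqrt_mul_sqrt_self A hA.nonneg

lemma psdSqrt_transpose (A : Matrix (Fin p) (Fin p) ℝ) :
    (psdSqrt A)ᵀ = psdSqrt A := by
  open scoped MatrixOrder in
  have h : (psdSqrt A).PosSemidef := Matrix.nonneg_iff_posSemidef.1 (CFC.sqrt_nonneg A)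
  have := h.isHermitian
  rwa [Matrix.IsHermitian, Matrix.conjTranspose_eq_transpose_of_trivial] at this

lemma dotProduct_psdSqrt_mulVec (A : Matrix (Fin p) (Fin p) ℝ) (u x : Fin p → ℝ) :
    u ⬝ᵥ (psdSqrt A *ᵥ x) = (psdSqrt A *ᵥ u) ⬝ᵥ x := by
  rw [Matrix.dotProduct_mulVec, ← Matrix.mulVec_transpose, psdSqrt_transpose]

lemma sqNorm_eq_dotProduct {ι : Type*} [Fintype ι] (v : ι → ℝ) : sqNorm v = v ⬝ᵥ v := by
  simp [sqNorm, dotProduct, pow_two]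

lemma sqNorm_nonneg {ι : Type*} [Fintype ι] (v : ι → ℝ) : 0 ≤ sqNorm v :=
  Finset.sum_nonneg fun _ _ => sq_nonneg _

lemma sqNorm_psdSqrt_mulVec {A : Matrix (Fin p) (Fin p) ℝ} (hA : A.PosSemidef)
    (u : Fin p → ℝ) : sqNorm (psdSqrt A *ᵥ u) = u ⬝ᵥ (A *ᵥ u) := by
  rw [sqNorm_eq_dotProduct, ← dotProduct_psdSqrt_mulVec, Matrix.mulVec_mulVec,
    psdSqrt_mul_self hA]

lemma IsGaussianWhiteNoise.hasLaw_noise (hε : IsGaussianWhiteNoise P ε)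
    {A : Matrix (Fin p) (Fin p) ℝ} (hA : A.PosSemidef) (t : ℤ) (u : Fin p → ℝ) :
    P.map (fun ω => u ⬝ᵥ (psdSqrt A *ᵥ ε t ω)) = gaussianReal 0 (u ⬝ᵥ (A *ᵥ u)).toNNReal := by
  simp_rw [dotProduct_psdSqrt_mulVec, hε.hasLaw_dotProduct, sqNorm_psdSqrt_mulVec hA]

lemma form_nonneg {A : Matrix (Fin p) (Fin p) ℝ} (hA : A.PosSemidef) (u : Fin p → ℝ) :
    0 ≤ u ⬝ᵥ (A *ᵥ u) := by
  rw [← sqNorm_psdSqrt_mulVec hA]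
  exact sqNorm_nonneg _

lemma IsGaussianWhiteNoise.hasGaussianLaw_noise (hε : IsGaussianWhiteNoise P ε)
    {A : Matrix (Fin p) (Fin p) ℝ} (hA : A.PosSemidef) (t : ℤ) (u : Fin p → ℝ) :
    HasGaussianLaw (fun ω => u ⬝ᵥ (psdSqrt A *ᵥ ε t ω)) P :=
  ⟨by rw [hε.hasLaw_noise hA]; infer_instance⟩

lemma IsGaussianWhiteNoise.variance_noise (hε : IsGaussianWhiteNoise P ε)
    {A : Matrix (Fin p) (Fin p) ℝ} (hA : A.PosSemidef) (t : ℤ) (u : Fin p → ℝ) :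
    Var[fun ω => u ⬝ᵥ (psdSqrt A *ᵥ ε t ω); P] = u ⬝ᵥ (A *ᵥ u) := by
  rw [← variance_id_map (hε.hasGaussianLaw_noise hA t u).aemeasurable, hε.hasLaw_noise hA,
    variance_id_gaussianReal, Real.coe_toNNReal _ (form_nonneg hA u)]

lemma IsGaussianWhiteNoise.integral_noise (hε : IsGaussianWhiteNoise P ε)
    {A : Matrix (Fin p) (Fin p) ℝ} (hA : A.PosSemidef) (t : ℤ) (u : Fin p → ℝ) :
    ∫ ω, u ⬝ᵥ (psdSqrt A *ᵥ ε t ω) ∂P = 0 := by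
  rw [← integral_map (φ := fun ω => u ⬝ᵥ (psdSqrt A *ᵥ ε t ω)) (f := fun x => x)
    (hε.hasGaussianLaw_noise hA t u).aemeasurable measurable_id.aestronglyMeasurable,
    hε.hasLaw_noise hA, integral_id_gaussianReal]

/-- If `ε t` is independent of the past of `Y`, it is independent of every random variable that
is almost surely determined by this past. -/
lemma indepFun_of_past {Y : ℤ → Ω → Fin p → ℝ} {t : ℤ}
    (hc : IndepFun (fun ω (s : Set.Iio t) => Y s ω) (ε t) P) {E : Type*} [TopologicalSpace E]
    [TopologicalSpace.PseudoMetrizableSpace E] [MeasurableSpace E] [BorelSpace E] {f : Ω → E}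
    (hf : AEStronglyMeasurable[pastSigma Y t] f P) {F : Type*} [MeasurableSpace F]
    {φ : (Fin p → ℝ) → F} (hφ : Measurable φ) : IndepFun f (fun ω => φ (ε t ω)) P := by
  obtain ⟨g, hg, hfg⟩ := hf
  refine IndepFun.congr ?_ hfg.symm ae_eq_rfl
  rw [IndepFun_iff_Indep] at hc ⊢
  refine indep_of_indep_of_le_right (indep_of_indep_of_le_left hc hg.measurable.comap_le) ?_
  rw [← Function.comp_def φ, ← MeasurableSpace.comap_comp]
  exact MeasurableSpace.comap_mono hφ.comap_le

lemma variance_linPast_add_noise {Y : ℤ → Ω → Fin p → ℝ} (hY : IsGaussianProcess Y P)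
    (hε : IsGaussianWhiteNoise P ε) {t : ℤ}
    (hc : IndepFun (fun ω (s : Set.Iio t) => Y s ω) (ε t) P) {f : Ω → ℝ} (hf : LinPast P Y t f)
    {A : Matrix (Fin p) (Fin p) ℝ} (hA : A.PosSemidef) (u : Fin p → ℝ) :
    Var[fun ω => f ω + u ⬝ᵥ (psdSqrt A *ᵥ ε t ω); P] = Var[f; P] + u ⬝ᵥ (A *ᵥ u) := by
  have hi : IndepFun f (fun ω => u ⬝ᵥ (psdSqrt A *ᵥ ε t ω)) P :=
    indepFun_of_past hc hf.aestronglyMeasurable (φ := fun x => u ⬝ᵥ (psdSqrt A *ᵥ x)) (by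
      simp only [dotProduct, Matrix.mulVec]
      fun_prop)
  rw [hi.variance_fun_add (hf.hasGaussianLaw hY).memLp_two
    (hε.hasGaussianLaw_noise hA t u).memLp_two, hε.variance_noise hA]

end Noise

/-! ### The dual of the companion matrix -/

section Dual

variable {p q : ℕ} [NeZero q]

/-- The transposed companion matrix of the autoregression with coefficients `Φ`, applied to the
coefficient vector `w` of a linear functional of the regressors. -/
def dualStep (Φ : Matrix (Fin p) (Fin q × Fin p) ℝ) (w : Fin q × Fin p → ℝ) :
    Fin q × Fin p → ℝ := fun lc =>
  ∑ k, w (0, k) * Φ k lc + if h : (lc.1 : ℕ) + 1 < q then w (⟨lc.1 + 1, h⟩, lc.2) else 0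

/-- The part of a functional of the regressors that acts on the most recent lag. -/
def headVec (w : Fin q × Fin p → ℝ) : Fin p → ℝ := fun k => w (0, k)

lemma dualStep_add (Φ : Matrix (Fin p) (Fin q × Fin p) ℝ) (w u : Fin q × Fin p → ℝ) :
    dualStep Φ (w + u) = dualStep Φ w + dualStep Φ u := by
  ext lc
  simp only [dualStep, Pi.add_apply, add_mul, Finset.sum_add_distrib]
  split_ifs <;> ring

/-- One step of the recursion, read off on a linear functional of the regressors. -/
lemma dotProduct_lagVec_succ (Φ : Matrix (Fin p) (Fin q × Fin p) ℝ) (w : Fin q × Fin p → ℝ)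
    (x : ℤ → Fin p → ℝ) (t : ℤ) :
    w ⬝ᵥ lagVec q x (t + 1)
      = dualStep Φ w ⬝ᵥ lagVec q x t + headVec w ⬝ᵥ (x t - Φ *ᵥ lagVec q x t) := by
  obtain ⟨r, rfl⟩ : ∃ r, q = r + 1 := Nat.exists_eq_succ_of_ne_zero (NeZero.ne q)
  have h1 : w ⬝ᵥ lagVec (r + 1) x (t + 1) = headVec w ⬝ᵥ x t
      + ∑ l : Fin r, ∑ c, w (l.succ, c) * x (t - 1 - (l : ℤ)) c := by
    simp only [dotProduct, lagVec, Fintype.sum_prod_type, headVec]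
    rw [Fin.sum_univ_succ]
    congr 1
    · simp
    · refine Finset.sum_congr rfl fun l _ => Finset.sum_congr rfl fun c _ => ?_
      rw [Fin.val_succ]
      congr 2
      push_cast
      ring
  have h2 : dualStep Φ w ⬝ᵥ lagVec (r + 1) x t
      = headVec w ⬝ᵥ (Φ *ᵥ lagVec (r + 1) x t)
        + ∑ l : Fin r, ∑ c, w (l.succ, c) * x (t - 1 - (l : ℤ)) c := by
    have : ∀ lc : Fin (r + 1) × Fin p, dualStep Φ w lc = (headVec w ᵥ* Φ) lc
        + if h : (lc.1 : ℕ) + 1 < r + 1 then w (⟨lc.1 + 1, h⟩, lc.2) else 0 := fun lc => rfl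
    rw [Matrix.dotProduct_mulVec]
    simp only [dotProduct, this, add_mul, Finset.sum_add_distrib]
    congr 1
    rw [Fintype.sum_prod_type, Fin.sum_univ_castSucc]
    simp [lagVec, Fin.succ]
  rw [h1, h2, dotProduct_sub]
  ring

end Dual

/-! ### Stationary Gaussian autoregressions -/

namespace IsStationaryGaussianVAR

variable {Ω : Type*} [mΩ : MeasurableSpace Ω] {P : Measure Ω} {p q : ℕ}
  {Φ : Matrix (Fin p) (Fin q × Fin p) ℝ} {Sig : Matrix (Fin p) (Fin p) ℝ}
  {ε Y : ℤ → Ω → Fin p → ℝ}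

lemma linPast_dotProduct_lagVec (Y : ℤ → Ω → Fin p → ℝ) (t : ℤ) (w : Fin q × Fin p → ℝ) :
    LinPast P Y t (fun ω => w ⬝ᵥ lagVec q (fun s => Y s ω) t) :=
  LinPast.dotProduct w fun lc => LinPast.of_lt (by
    have : (0 : ℤ) ≤ (lc.1 : ℤ) := by positivity
    omega) lc.2

lemma memLp (hY : IsStationaryGaussianVAR P Φ Sig ε Y) (t : ℤ) (c : Fin p) :
    MemLp (fun ω => Y t ω c) 2 P :=
  ((LinPast.of_lt (lt_add_one t) c).hasGaussianLaw hY.gaussian).memLp_two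

lemma covariance_eq (hY : IsStationaryGaussianVAR P Φ Sig ε Y) (s t : ℤ) (i k : Fin p) :
    cov[fun ω => Y s ω i, fun ω => Y t ω k; P] = autocov P Y (t - s) i k := by
  have hm : ∀ h : ℤ, Measurable (fun ω (t : ℤ) => Y (t + h) ω) := fun h =>
    measurable_pi_lambda _ fun t => hY.measurable _
  have key : ∀ h : ℤ, cov[fun z : ℤ → Fin p → ℝ => z 0 i, fun z => z (t - s) k;
      P.map (fun ω t => Y (t + h) ω)] = cov[fun ω => Y h ω i, fun ω => Y (t - s + h) ω k; P] := by
    intro h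
    rw [covariance_map_fun (Measurable.aestronglyMeasurable (by fun_prop))
      (Measurable.aestronglyMeasurable (by fun_prop)) (hm h).aemeasurable]
    simp
  have h0 := key 0
  have hs := key s
  rw [hY.stationary s] at hs
  simp only [add_zero] at h0
  rw [h0] at hs
  simp only [sub_add_cancel] at hs
  exact hs.symm

lemma variance_sum_eq (hY : IsStationaryGaussianVAR P Φ Sig ε Y) [IsProbabilityMeasure P]
    (S : Finset ℤ) (v : ℤ → Fin p → ℝ) :
    Var[fun ω => ∑ t ∈ S, v t ⬝ᵥ Y t ω; P] = autocovForm (autocov P Y) S v := by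
  have hm : ∀ t, MemLp (fun ω => v t ⬝ᵥ Y t ω) 2 P := fun t =>
    memLp_finsetSum _ fun i _ => (hY.memLp t i).const_mul (v t i)
  rw [variance_fun_sum' fun t _ => hm t, autocovForm]
  refine Finset.sum_congr rfl fun s _ => Finset.sum_congr rfl fun t _ => ?_
  simp only [dotProduct]
  rw [covariance_fun_sum_fun_sum (fun i => (hY.memLp s i).const_mul (v s i))
    (fun i => (hY.memLp t i).const_mul (v t i))]
  refine Finset.sum_congr rfl fun i _ => Finset.sum_congr rfl fun k _ => ?_
  rw [covariance_const_mul_left, covariance_const_mul_right, hY.covariance_eq]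
  ring

/-- `w ⬝ᵥ lagVec` as a sum over times. -/
lemma dotProduct_lagVec_eq_sum (x : ℤ → Fin p → ℝ) (t : ℤ) (w : Fin q × Fin p → ℝ) :
    w ⬝ᵥ lagVec q x t = ∑ l : Fin q, (fun c => w (l, c)) ⬝ᵥ x (t - 1 - (l : ℤ)) := by
  simp only [dotProduct, lagVec, Fintype.sum_prod_type]

/-- The variance of the linear functional with coefficients `w` of the regressors. -/
noncomputable def lagForm (P : Measure Ω) (Y : ℤ → Ω → Fin p → ℝ) (w : Fin q × Fin p → ℝ) : ℝ :=
  Var[fun ω => w ⬝ᵥ lagVec q (fun s => Y s ω) 0; P]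

lemma sum_image_bounds (hY : IsStationaryGaussianVAR P Φ Sig ε Y) [IsProbabilityMeasure P]
    {a b : ℝ} (hs : SpectrumBetween (autocov P Y) a b) {ι : Type*} [Fintype ι] {τ : ι → ℤ}
    (hτ : Function.Injective τ) (u : ι → Fin p → ℝ) :
    2 * Real.pi * a * ∑ i, sqNorm (u i) ≤ Var[fun ω => ∑ i, u i ⬝ᵥ Y (τ i) ω; P] ∧
      Var[fun ω => ∑ i, u i ⬝ᵥ Y (τ i) ω; P] ≤ 2 * Real.pi * b * ∑ i, sqNorm (u i) := by
  have h := hs.autocovForm_bounds (Finset.univ.map ⟨τ, hτ⟩) (Function.extend τ u 0)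
  rw [← hY.variance_sum_eq] at h
  simpa [hτ.extend_apply] using h

lemma variance_lagVec (hY : IsStationaryGaussianVAR P Φ Sig ε Y) (t : ℤ)
    (w : Fin q × Fin p → ℝ) :
    Var[fun ω => w ⬝ᵥ lagVec q (fun s => Y s ω) t; P] = lagForm P Y w := by
  have hm : ∀ h : ℤ, Measurable (fun ω (t : ℤ) => Y (t + h) ω) := fun h =>
    measurable_pi_lambda _ fun t => hY.measurable _
  have hw : Measurable fun z : ℤ → Fin p → ℝ => w ⬝ᵥ lagVec q z 0 := by
    simp only [dotProduct, lagVec]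
    fun_prop
  have key : ∀ h : ℤ, Var[fun z : ℤ → Fin p → ℝ => w ⬝ᵥ lagVec q z 0;
      P.map (fun ω t => Y (t + h) ω)]
      = Var[fun ω => w ⬝ᵥ lagVec q (fun s => Y s ω) h; P] := by
    intro h
    rw [variance_map hw.aemeasurable (hm h).aemeasurable]
    congr 1
    ext ω
    simp only [Function.comp, dotProduct, lagVec]
    refine Finset.sum_congr rfl fun lc _ => ?_
    rw [show (0 : ℤ) - 1 - lc.1 + h = h - 1 - lc.1 by ring]
  rw [← key t, hY.stationary t, lagForm]
  have := key 0
  simp only [add_zero] at this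
  exact this

lemma lagForm_bounds (hY : IsStationaryGaussianVAR P Φ Sig ε Y) [IsProbabilityMeasure P]
    {a b : ℝ} (hs : SpectrumBetween (autocov P Y) a b) (w : Fin q × Fin p → ℝ) :
    2 * Real.pi * a * sqNorm w ≤ lagForm P Y w ∧ lagForm P Y w ≤ 2 * Real.pi * b * sqNorm w := by
  have hτ : Function.Injective fun l : Fin q => (0 - 1 - (l : ℤ) : ℤ) := by
    intro l l' h
    apply Fin.ext
    simp only at h
    omega
  have h := hY.sum_image_bounds hs hτ fun l c => w (l, c)
  simp only [lagForm, dotProduct_lagVec_eq_sum]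
  have : sqNorm w = ∑ l : Fin q, sqNorm fun c => w (l, c) := by
    simp [sqNorm, Fintype.sum_prod_type]
  rw [this]
  exact h

/-- A functional of `q` consecutive observations cannot be predicted from the `q` preceding ones
with an error variance below `2πa` times its squared norm. -/
lemma le_variance_lagVec_sub (hY : IsStationaryGaussianVAR P Φ Sig ε Y) [IsProbabilityMeasure P]
    {a b : ℝ} (ha : 0 ≤ a) (hs : SpectrumBetween (autocov P Y) a b) (w u : Fin q × Fin p → ℝ) :
    2 * Real.pi * a * sqNorm w ≤ Var[fun ω => w ⬝ᵥ lagVec q (fun s => Y s ω) (q : ℤ)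
      - u ⬝ᵥ lagVec q (fun s => Y s ω) 0; P] := by
  let τ : Fin q ⊕ Fin q → ℤ := Sum.elim (fun l => q - 1 - (l : ℤ)) fun l => 0 - 1 - (l : ℤ)
  have hτ : Function.Injective τ := by
    rintro (l | l) (l' | l') h <;> simp only [τ, Sum.elim_inl, Sum.elim_inr] at h
    · exact congrArg Sum.inl (Fin.ext (by omega))
    · have := l.2; omega
    · have := l'.2; omega
    · exact congrArg Sum.inr (Fin.ext (by omega))
  have h := (hY.sum_image_bounds hs hτ
    (Sum.elim (fun l c => w (l, c)) fun l c => -u (l, c))).1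
  have h1 : sqNorm w = ∑ l : Fin q, sqNorm fun c => w (l, c) := by
    simp [sqNorm, Fintype.sum_prod_type]
  have h2 : (fun ω => w ⬝ᵥ lagVec q (fun s => Y s ω) (q : ℤ)
      - u ⬝ᵥ lagVec q (fun s => Y s ω) 0) = fun ω => ∑ i, (Sum.elim (fun l c => w (l, c))
        fun l c => -u (l, c) : Fin q ⊕ Fin q → Fin p → ℝ) i ⬝ᵥ Y (τ i) ω := by
    ext ω
    rw [dotProduct_lagVec_eq_sum, dotProduct_lagVec_eq_sum]
    simp [τ, dotProduct, Finset.sum_neg_distrib, sub_eq_add_neg]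
  rw [h2]
  refine le_trans ?_ h
  rw [Fintype.sum_sum_type, h1]
  have : 0 ≤ ∑ l : Fin q, sqNorm fun c => -u (l, c) :=
    Finset.sum_nonneg fun _ _ => sqNorm_nonneg _
  have hπ := Real.pi_pos
  refine mul_le_mul_of_nonneg_left ?_ (by positivity)
  simpa using this

/-- The innovations have a nondegenerate covariance matrix. -/
lemma le_form_Sig (hY : IsStationaryGaussianVAR P Φ Sig ε Y) [IsProbabilityMeasure P]
    (hε : IsGaussianWhiteNoise P ε) (hSig : Sig.PosSemidef)
    {a b : ℝ} (ha : 0 ≤ a) (hs : SpectrumBetween (autocov P Y) a b) (u : Fin p → ℝ) :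
    2 * Real.pi * a * sqNorm u ≤ u ⬝ᵥ (Sig *ᵥ u) := by
  let τ : Unit ⊕ Fin q → ℤ := Sum.elim (fun _ => 0) fun l => 0 - 1 - (l : ℤ)
  have hτ : Function.Injective τ := by
    rintro (l | l) (l' | l') h <;> simp only [τ, Sum.elim_inl, Sum.elim_inr] at h
    · rfl
    · omega
    · omega
    · exact congrArg Sum.inr (Fin.ext (by omega))
  have h := (hY.sum_image_bounds hs hτ
    (Sum.elim (fun _ => u) fun l c => -(u ᵥ* Φ) (l, c))).1
  rw [← hε.variance_noise hSig 0 u]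
  have h2 : (fun ω => u ⬝ᵥ (psdSqrt Sig *ᵥ ε 0 ω)) =ᵐ[P] fun ω => ∑ i, (Sum.elim (fun _ => u)
      fun l c => -(u ᵥ* Φ) (l, c) : Unit ⊕ Fin q → Fin p → ℝ) i ⬝ᵥ Y (τ i) ω := by
    filter_upwards [hY.recursion 0] with ω hω
    have : psdSqrt Sig *ᵥ ε 0 ω = Y 0 ω - Φ *ᵥ lagVec q (fun s => Y s ω) 0 := by
      rw [hω]; simp
    rw [this, dotProduct_sub, Matrix.dotProduct_mulVec, dotProduct_lagVec_eq_sum]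
    simp [τ, dotProduct, Finset.sum_neg_distrib, sub_eq_add_neg]
  rw [variance_congr h2]
  refine le_trans ?_ h
  rw [Fintype.sum_sum_type]
  have : 0 ≤ ∑ l : Fin q, sqNorm fun c => -(u ᵥ* Φ) (l, c) :=
    Finset.sum_nonneg fun _ _ => sqNorm_nonneg _
  have hπ := Real.pi_pos
  refine mul_le_mul_of_nonneg_left ?_ (by positivity)
  simpa using this

section

variable [NeZero q]

lemma lagVec_succ_ae (hY : IsStationaryGaussianVAR P Φ Sig ε Y) (w : Fin q × Fin p → ℝ) (t : ℤ) :
    ∀ᵐ ω ∂P, w ⬝ᵥ lagVec q (fun s => Y s ω) (t + 1)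
      = dualStep Φ w ⬝ᵥ lagVec q (fun s => Y s ω) t
        + headVec w ⬝ᵥ (psdSqrt Sig *ᵥ ε t ω) := by
  filter_upwards [hY.recursion t] with ω hω
  rw [dotProduct_lagVec_succ Φ]
  congr 2
  rw [hω]
  simp

/-- The variance of a functional splits into those of its one-step prediction and of the
innovation. -/
lemma lagForm_eq (hY : IsStationaryGaussianVAR P Φ Sig ε Y)
    (hε : IsGaussianWhiteNoise P ε) (hSig : Sig.PosSemidef) (w : Fin q × Fin p → ℝ) :
    lagForm P Y w = lagForm P Y (dualStep Φ w) + headVec w ⬝ᵥ (Sig *ᵥ headVec w) := by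
  have h := variance_linPast_add_noise hY.gaussian hε (hY.causal 0)
      (linPast_dotProduct_lagVec Y 0 (dualStep Φ w)) hSig (headVec w)
  rw [hY.variance_lagVec] at h
  rw [← h, ← hY.variance_lagVec (0 + 1) w]
  exact variance_congr (hY.lagVec_succ_ae w 0)

/-- The variance of the forecast error of a functional, minus an arbitrary functional of the past,
at horizon `k`. -/
lemma variance_lagVec_sub (hY : IsStationaryGaussianVAR P Φ Sig ε Y)
    (hε : IsGaussianWhiteNoise P ε) (hSig : Sig.PosSemidef) {f : Ω → ℝ} (hf : LinPast P Y 0 f)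
    (k : ℕ) (w : Fin q × Fin p → ℝ) :
    Var[fun ω => w ⬝ᵥ lagVec q (fun s => Y s ω) (k : ℤ) - f ω; P]
      = Var[fun ω => (dualStep Φ)^[k] w ⬝ᵥ lagVec q (fun s => Y s ω) 0 - f ω; P]
        + (lagForm P Y w - lagForm P Y ((dualStep Φ)^[k] w)) := by
  have step : ∀ (g : Ω → ℝ) (k : ℕ) (w : Fin q × Fin p → ℝ), LinPast P Y 0 g →
      Var[fun ω => w ⬝ᵥ lagVec q (fun s => Y s ω) ((k + 1 : ℕ) : ℤ) - g ω; P]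
      = Var[fun ω => dualStep Φ w ⬝ᵥ lagVec q (fun s => Y s ω) (k : ℤ) - g ω; P]
        + headVec w ⬝ᵥ (Sig *ᵥ headVec w) := by
    intro g k w hg
    rw [← variance_linPast_add_noise hY.gaussian hε (hY.causal k)
      ((linPast_dotProduct_lagVec Y k (dualStep Φ w)).sub (hg.mono (by positivity))) hSig]
    refine variance_congr ?_
    filter_upwards [hY.lagVec_succ_ae w k] with ω hω
    push_cast
    rw [hω]
    ring
  induction k generalizing w with
  | zero => simp
  | succ k ih =>
    rw [step f k w hf, ih, hY.lagForm_eq hε hSig w, Function.iterate_succ_apply]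
    ring

lemma lagForm_dualStep_le (hY : IsStationaryGaussianVAR P Φ Sig ε Y)
    (hε : IsGaussianWhiteNoise P ε) (hSig : Sig.PosSemidef) (w : Fin q × Fin p → ℝ) :
    lagForm P Y (dualStep Φ w) ≤ lagForm P Y w := by
  rw [hY.lagForm_eq hε hSig w]
  exact le_add_of_nonneg_right (form_nonneg hSig _)

/-- `q` steps of the dual recursion contract the variance form by the factor `1 - a / b`. -/
lemma lagForm_iterate_le (hY : IsStationaryGaussianVAR P Φ Sig ε Y) [IsProbabilityMeasure P]
    (hε : IsGaussianWhiteNoise P ε) (hSig : Sig.PosSemidef) {a b : ℝ} (ha : 0 < a) (hb : 0 < b)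
    (hs : SpectrumBetween (autocov P Y) a b) (w : Fin q × Fin p → ℝ) :
    lagForm P Y ((dualStep Φ)^[q] w) ≤ (1 - a / b) * lagForm P Y w := by
  have h := hY.variance_lagVec_sub hε hSig
    (linPast_dotProduct_lagVec Y 0 ((dualStep Φ)^[q] w)) q w
  simp only [sub_self] at h
  have h0 : Var[fun _ : Ω => (0 : ℝ); P] = 0 := variance_zero P
  rw [h0, zero_add] at h
  have h1 := hY.le_variance_lagVec_sub ha.le hs w ((dualStep Φ)^[q] w)
  rw [h] at h1
  have h2 := (hY.lagForm_bounds hs w).2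
  have h3 : a / b * lagForm P Y w ≤ 2 * Real.pi * a * sqNorm w := by
    calc a / b * lagForm P Y w ≤ a / b * (2 * Real.pi * b * sqNorm w) := by gcongr
      _ = _ := by field_simp
  linarith

/-- A stationary Gaussian autoregression with a spectral density bounded from above and away
from zero is centered. -/
lemma integral_lagVec_eq_zero (hY : IsStationaryGaussianVAR P Φ Sig ε Y) [IsProbabilityMeasure P]
    (hε : IsGaussianWhiteNoise P ε) (hSig : Sig.PosSemidef) {a b : ℝ} (ha : 0 < a) (hb : 0 < b)
    (hab : a ≤ b) (hs : SpectrumBetween (autocov P Y) a b) (t : ℤ) (w : Fin q × Fin p → ℝ) :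
    ∫ ω, w ⬝ᵥ lagVec q (fun s => Y s ω) t ∂P = 0 := by
  have hint : ∀ s c, ∫ ω, Y s ω c ∂P = ∫ ω, Y 0 ω c ∂P := by
    intro s c
    have hm : ∀ h : ℤ, Measurable (fun ω (t : ℤ) => Y (t + h) ω) := fun h =>
      measurable_pi_lambda _ fun t => hY.measurable _
    have key : ∀ h : ℤ, ∫ z, z 0 c ∂(P.map (fun ω (t : ℤ) => Y (t + h) ω))
        = ∫ ω, Y h ω c ∂P := by
      intro h
      rw [integral_map (hm h).aemeasurable (Measurable.aestronglyMeasurable (by fun_prop))]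
      simp
    have h0 := key 0
    simp only [add_zero] at h0
    rw [← key s, hY.stationary s, h0]
  have hI : ∀ s c, Integrable (fun ω => Y s ω c) P := fun s c =>
    (hY.memLp s c).integrable (by norm_num)
  let m : Fin q × Fin p → ℝ := fun lc => ∫ ω, Y 0 ω lc.2 ∂P
  have hm : ∀ t w, ∫ ω, w ⬝ᵥ lagVec q (fun s => Y s ω) t ∂P = w ⬝ᵥ m := by
    intro t w
    simp only [dotProduct, lagVec, m]
    rw [integral_finsetSum _ fun lc _ => (hI _ _).const_mul _]
    refine Finset.sum_congr rfl fun lc _ => ?_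
    rw [integral_const_mul, hint]
  -- the dual recursion preserves the mean of every functional but contracts its variance form
  have hstep : ∀ w, w ⬝ᵥ m = dualStep Φ w ⬝ᵥ m := by
    intro w
    rw [← hm (0 + 1) w, ← hm 0 (dualStep Φ w), integral_congr_ae (hY.lagVec_succ_ae w 0),
      integral_add, hε.integral_noise hSig, add_zero]
    · exact ((linPast_dotProduct_lagVec Y 0 _).hasGaussianLaw hY.gaussian).integrable
    · exact (hε.hasGaussianLaw_noise hSig 0 _).integrable
  have hiter : ∀ k w, w ⬝ᵥ m = (dualStep Φ)^[k] w ⬝ᵥ m := by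
    intro k
    induction k with
    | zero => simp
    | succ k ih => intro w; rw [hstep, ih, Function.iterate_succ_apply]
  have hdecay : ∀ k w, lagForm P Y (((dualStep Φ)^[q])^[k] w) ≤ (1 - a / b) ^ k * lagForm P Y w := by
    intro k
    have h0 : 0 ≤ 1 - a / b := by
      rw [sub_nonneg, div_le_one hb]
      exact hab
    induction k with
    | zero => simp
    | succ k ih =>
      intro w
      rw [Function.iterate_succ_apply, pow_succ, mul_assoc]
      exact (ih _).trans
        (mul_le_mul_of_nonneg_left (hY.lagForm_iterate_le hε hSig ha hb hs w) (pow_nonneg h0 k))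
  rw [hm]
  have hsq : ∀ k, (w ⬝ᵥ m) ^ 2 ≤ (1 - a / b) ^ k * (lagForm P Y w / (2 * Real.pi * a) * sqNorm m) := by
    intro k
    have hπ := Real.pi_pos
    set u := ((dualStep Φ)^[q])^[k] w with hu
    have h1 : w ⬝ᵥ m = u ⬝ᵥ m := by
      rw [hu, ← Function.iterate_mul]
      exact hiter _ w
    have h2 : (u ⬝ᵥ m) ^ 2 ≤ sqNorm u * sqNorm m := by
      simp only [dotProduct, sqNorm]
      exact Finset.sum_mul_sq_le_sq_mul_sq _ _ _
    have h3 : sqNorm u ≤ (1 - a / b) ^ k * (lagForm P Y w / (2 * Real.pi * a)) := by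
      rw [← mul_div_assoc, le_div_iff₀ (by positivity), mul_comm]
      exact ((hY.lagForm_bounds hs u).1).trans (hdecay k w)
    rw [h1]
    refine h2.trans ?_
    rw [← mul_assoc]
    exact mul_le_mul_of_nonneg_right h3 (sqNorm_nonneg m)
  have hlim : Tendsto (fun k : ℕ => (1 - a / b) ^ k *
      (lagForm P Y w / (2 * Real.pi * a) * sqNorm m)) atTop (𝓝 0) := by
    have : Tendsto (fun k : ℕ => (1 - a / b) ^ k) atTop (𝓝 0) := by
      refine tendsto_pow_atTop_nhds_zero_of_lt_one ?_ ?_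
      · rw [sub_nonneg, div_le_one hb]
        exact hab
      · have : 0 < a / b := by positivity
        linarith
    simpa using this.mul_const (lagForm P Y w / (2 * Real.pi * a) * sqNorm m)
  have := ge_of_tendsto' hlim hsq
  nlinarith [sq_nonneg (w ⬝ᵥ m)]

end

end IsStationaryGaussianVAR

/-! ### A Lyapunov form for the dual recursion -/

section Lyapunov

variable {E : Type*}

/-- The form `∑_{k < q} θ^{-k} G (T^k w)`, which decreases by the factor `θ` in every single step
of `T` when `G` decreases by the factor `θ^q` in `q` steps. -/
noncomputable def lyapunov (G : E → ℝ) (T : E → E) (θ : ℝ) (q : ℕ) (w : E) : ℝ :=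
  ∑ k ∈ Finset.range q, θ⁻¹ ^ k * G (T^[k] w)

variable {G : E → ℝ} {T : E → E} {θ : ℝ} {q : ℕ}

lemma lyapunov_step_le (hθ : 0 < θ) (hq : ∀ w, G (T^[q] w) ≤ θ ^ q * G w) (w : E) :
    lyapunov G T θ q (T w) ≤ θ * lyapunov G T θ q w := by
  have h1 : lyapunov G T θ q (T w)
      = θ * ∑ k ∈ Finset.range q, θ⁻¹ ^ (k + 1) * G (T^[k + 1] w) := by
    rw [lyapunov, Finset.mul_sum]
    refine Finset.sum_congr rfl fun k _ => ?_
    rw [Function.iterate_succ_apply, pow_succ]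
    field_simp
  have h2 := Finset.sum_range_succ' (fun k => θ⁻¹ ^ k * G (T^[k] w)) q
  rw [Finset.sum_range_succ] at h2
  have h3 : θ⁻¹ ^ q * G (T^[q] w) ≤ G w := by
    calc θ⁻¹ ^ q * G (T^[q] w) ≤ θ⁻¹ ^ q * (θ ^ q * G w) := by gcongr; exact hq w
      _ = G w := by rw [← mul_assoc, ← mul_pow, inv_mul_cancel₀ hθ.ne', one_pow, one_mul]
  rw [h1]
  refine mul_le_mul_of_nonneg_left ?_ hθ.le
  rw [lyapunov]
  simp only [pow_zero, Function.iterate_zero, id, one_mul] at h2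
  linarith

lemma le_lyapunov (hθ : 0 < θ) (hG : ∀ w, 0 ≤ G w) (hq : 0 < q) (w : E) :
    G w ≤ lyapunov G T θ q w := by
  have := Finset.single_le_sum (f := fun k => θ⁻¹ ^ k * G (T^[k] w))
    (fun k _ => mul_nonneg (by positivity) (hG _)) (Finset.mem_range.2 hq)
  simpa [lyapunov] using this

lemma lyapunov_le (hθ : 0 < θ) (hθ1 : θ ≤ 1) (hG : ∀ w, 0 ≤ G w) (hT : ∀ w, G (T w) ≤ G w)
    (w : E) : lyapunov G T θ q w ≤ q * θ⁻¹ ^ q * G w := by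
  have hit : ∀ k w, G (T^[k] w) ≤ G w := by
    intro k
    induction k with
    | zero => simp
    | succ k ih =>
      intro w
      rw [Function.iterate_succ_apply]
      exact (ih _).trans (hT w)
  have : ∀ k ∈ Finset.range q, θ⁻¹ ^ k * G (T^[k] w) ≤ θ⁻¹ ^ q * G w := by
    intro k hk
    refine mul_le_mul ?_ (hit k w) (hG _) (by positivity)
    exact pow_le_pow_right₀ ((one_le_inv₀ hθ).2 hθ1) (Finset.mem_range.1 hk).le
  refine (Finset.sum_le_sum this).trans ?_
  simp [mul_assoc]

lemma lyapunov_add_le [AddCommGroup E] (hθ : 0 < θ) {δ : ℝ}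
    (hT : ∀ x y, T (x + y) = T x + T y)
    (hG : ∀ x y, G (x + y) ≤ (1 + δ) * G x + (1 + 1 / δ) * G y) (x y : E) :
    lyapunov G T θ q (x + y)
      ≤ (1 + δ) * lyapunov G T θ q x + (1 + 1 / δ) * lyapunov G T θ q y := by
  have hit : ∀ k x y, T^[k] (x + y) = T^[k] x + T^[k] y := by
    intro k
    induction k with
    | zero => simp
    | succ k ih => intro x y; simp [Function.iterate_succ_apply, hT, ih]
  simp only [lyapunov, Finset.mul_sum, ← Finset.sum_add_distrib]
  refine Finset.sum_le_sum fun k _ => ?_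
  rw [hit]
  calc θ⁻¹ ^ k * G (T^[k] x + T^[k] y)
      ≤ θ⁻¹ ^ k * ((1 + δ) * G (T^[k] x) + (1 + 1 / δ) * G (T^[k] y)) := by
        gcongr
        exact hG _ _
    _ = _ := by ring

end Lyapunov

/-! ### Propagation of variance bounds through the segments -/

section Propagation

variable {E : Type*} [AddCommGroup E] [Module ℝ E]

/-- Within a segment the excess `B` over the stationary level decays geometrically. The form `W t`
stands for the variance of a functional at time `t`, `T` for the dual recursion, `V` for its
Lyapunov form with contraction factor `1 - x`, `N` for the variance of the innovation, and `g` for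
the weights of the observations, each of which is read off in the direction `e`. With
`A = (1 + x) / x ^ 2`, the level `A` is a fixed point of `A ↦ ((1 - x) A + 1) (1 + x)`. -/
lemma segment_bound {V N : E → ℝ} {T : E → E} {W : ℕ → E → ℝ} {g : ℕ → ℝ} {e : E}
    {x κ A B D R : ℝ} {s s' : ℕ} (hx : 0 < x) (hx1 : x < 1) (hκ : 0 ≤ κ)
    (hA : A = (1 + x) / x ^ 2) (hB : 0 ≤ B) (hBD : B ≤ D)
    (hadd : ∀ u w, V (u + w) ≤ (1 + x) * V u + (1 + 1 / x) * V w)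
    (hT : ∀ w, V (T w) ≤ (1 - x) * V w) (hN : ∀ w, N w ≤ V w)
    (he : ∀ r : ℝ, V (r • e) ≤ κ * r ^ 2)
    (hW : ∀ t, s ≤ t → t < s' → ∀ w, W (t + 1) w = W t (T (w + g t • e)) + N (w + g t • e))
    (h0 : ∀ w, W s w ≤ (A + B) * V w + R) (k : ℕ) (hk : s + k ≤ s') (w : E) :
    W (s + k) w ≤ (A + (1 - x ^ 2) ^ k * B) * V w + R
      + (A + D + 1) * (1 + 1 / x) * κ * ∑ i ∈ Finset.Ico s (s + k), g i ^ 2 := by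
  have hA0 : 0 < A := by rw [hA]; positivity
  have hτ0 : 0 ≤ 1 - x ^ 2 := by nlinarith
  have hτ1 : 1 - x ^ 2 ≤ 1 := by nlinarith
  induction k generalizing w with
  | zero => simpa using h0 w
  | succ k ih =>
    set F := (1 - x ^ 2) ^ k * B with hF
    have hF0 : 0 ≤ F := by positivity
    have hFD : F ≤ D := by
      refine le_trans ?_ hBD
      exact mul_le_of_le_one_left hB (pow_le_one₀ hτ0 hτ1)
    set w' := w + g (s + k) • e with hw'
    have h1 := ih (by omega) (T w')
    have h2 := hW (s + k) (by omega) (by omega) w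
    rw [← hw'] at h2
    have h3 := hadd w (g (s + k) • e)
    have h4 := he (g (s + k))
    have h5 := hT w'
    have h6 := hN w'
    rw [← hw'] at h3
    -- the multiplier that the recursion puts in front of `V w'`
    set m := (1 - x) * (A + F) + 1 with hm
    have hm0 : 0 ≤ m := by
      have : 0 ≤ (1 - x) * (A + F) := mul_nonneg (by linarith) (by linarith)
      linarith
    have hmD : m ≤ A + D + 1 := by
      have : (1 - x) * (A + F) ≤ A + F := mul_le_of_le_one_left (by linarith) (by linarith)
      linarith
    have h7 : W (s + k + 1) w ≤ m * V w' + R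
        + (A + D + 1) * (1 + 1 / x) * κ * ∑ i ∈ Finset.Ico s (s + k), g i ^ 2 := by
      have : (A + F) * V (T w') ≤ (A + F) * ((1 - x) * V w') :=
        mul_le_mul_of_nonneg_left h5 (by linarith)
      rw [h2, hm]
      linarith
    have h8 : m * V w' ≤ m * (1 + x) * V w + (A + D + 1) * (1 + 1 / x) * κ * g (s + k) ^ 2 := by
      have h9 : m * V w' ≤ m * ((1 + x) * V w + (1 + 1 / x) * (κ * g (s + k) ^ 2)) := by
        refine mul_le_mul_of_nonneg_left (h3.trans ?_) hm0
        gcongr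
      have h10 : m * ((1 + 1 / x) * (κ * g (s + k) ^ 2))
          ≤ (A + D + 1) * ((1 + 1 / x) * (κ * g (s + k) ^ 2)) := by gcongr
      linarith
    have h11 : m * (1 + x) = A + (1 - x ^ 2) ^ (k + 1) * B := by
      have : A * x ^ 2 = 1 + x := by rw [hA]; field_simp
      rw [pow_succ, hm, hF]
      linear_combination -this
    rw [h11] at h8
    rw [← add_assoc s k 1, Finset.sum_Ico_succ_top (by omega)]
    linarith

/-- Bounds for the forms `W t`, uniform over all segments: at a break point the form of the old
segment is dominated by `ρ` times that of the new one, and the segments `2, …, m0` are long enough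
for this loss to be compensated. The first segment starts without any excess, and the last one is
not followed by a break, so that their lengths do not matter. -/
lemma multisegment_bound {m0 L : ℕ} {br : ℕ → ℕ} (hbr0 : br 0 = 0)
    (hbr : ∀ j ≤ m0, br j < br (j + 1)) (hgap : ∀ j, 1 ≤ j → j < m0 → br j + L ≤ br (j + 1))
    {V N : ℕ → E → ℝ} {T : ℕ → E → E} {W : ℕ → E → ℝ} {g : ℕ → ℝ} {e : E} {x κ ρ A : ℝ}
    (hx : 0 < x) (hx1 : x < 1) (hκ : 0 ≤ κ) (hρ : 1 ≤ ρ) (hA : A = (1 + x) / x ^ 2)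
    (hL : ρ * (1 - x ^ 2) ^ L ≤ 1 / 2)
    (hV0 : ∀ j ∈ Finset.Icc 1 (m0 + 1), ∀ w, 0 ≤ V j w)
    (hadd : ∀ j ∈ Finset.Icc 1 (m0 + 1), ∀ u w,
      V j (u + w) ≤ (1 + x) * V j u + (1 + 1 / x) * V j w)
    (hT : ∀ j ∈ Finset.Icc 1 (m0 + 1), ∀ w, V j (T j w) ≤ (1 - x) * V j w)
    (hN : ∀ j ∈ Finset.Icc 1 (m0 + 1), ∀ w, N j w ≤ V j w)
    (he : ∀ j ∈ Finset.Icc 1 (m0 + 1), ∀ r : ℝ, V j (r • e) ≤ κ * r ^ 2)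
    (hcomp : ∀ j ∈ Finset.Icc 1 (m0 + 1), ∀ i ∈ Finset.Icc 1 (m0 + 1), ∀ w, V j w ≤ ρ * V i w)
    (hW : ∀ j ∈ Finset.Icc 1 (m0 + 1), ∀ t, br (j - 1) ≤ t → t < br j → ∀ w,
      W (t + 1) w = W t (T j (w + g t • e)) + N j (w + g t • e))
    (h0 : ∀ w, W 0 w ≤ V 1 w) :
    W (br (m0 + 1)) 0 ≤ (A + 2 * ρ * A + 1) * (1 + 1 / x) * κ *
      ∑ i ∈ Finset.range (br (m0 + 1)), g i ^ 2 := by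
  have hA0 : 0 < A := by rw [hA]; positivity
  have hA1 : 1 ≤ A := by
    rw [hA, le_div_iff₀ (by positivity)]
    nlinarith
  have hτ0 : 0 ≤ 1 - x ^ 2 := by nlinarith
  have hτ1 : 1 - x ^ 2 ≤ 1 := by nlinarith
  set D := 2 * ρ * A with hD
  have hD0 : 0 < D := by positivity
  set K := (A + D + 1) * (1 + 1 / x) * κ with hK
  have seg : ∀ j ∈ Finset.Icc 1 (m0 + 1), ∀ B, 0 ≤ B → B ≤ D →
      (∀ w, W (br (j - 1)) w ≤ (A + B) * V j w
        + K * ∑ i ∈ Finset.range (br (j - 1)), g i ^ 2) →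
      ∀ w, W (br j) w ≤ (A + (1 - x ^ 2) ^ (br j - br (j - 1)) * B) * V j w
        + K * ∑ i ∈ Finset.range (br j), g i ^ 2 := by
    intro j hj B hB hBD hstart w
    have hj' := Finset.mem_Icc.1 hj
    have hlt : br (j - 1) < br j := by
      have := hbr (j - 1) (by omega)
      rwa [Nat.sub_add_cancel hj'.1] at this
    have h := segment_bound hx hx1 hκ hA hB hBD (hadd j hj) (hT j hj) (hN j hj) (he j hj)
      (hW j hj) hstart (br j - br (j - 1)) (by omega) w
    rw [Nat.add_sub_cancel' hlt.le, ← hK] at h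
    have hsum : ∑ i ∈ Finset.range (br (j - 1)), g i ^ 2
        + ∑ i ∈ Finset.Ico (br (j - 1)) (br j), g i ^ 2 = ∑ i ∈ Finset.range (br j), g i ^ 2 :=
      Finset.sum_range_add_sum_Ico _ hlt.le
    rw [← hsum, mul_add]
    linarith
  have main : ∀ j, j ≤ m0 → ∃ B, 0 ≤ B ∧ B ≤ D ∧ (j = 0 → B = 0) ∧
      ∀ w, W (br j) w ≤ (A + B) * V (j + 1) w + K * ∑ i ∈ Finset.range (br j), g i ^ 2 := by
    intro j
    induction j with
    | zero =>
      intro _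
      refine ⟨0, le_rfl, hD0.le, fun _ => rfl, fun w => ?_⟩
      have hV := hV0 1 (by simp) w
      simp only [hbr0, Finset.range_zero, Finset.sum_empty, mul_zero, add_zero, zero_add]
      exact (h0 w).trans (le_mul_of_one_le_left hV hA1)
    | succ j ih =>
      intro hj
      obtain ⟨B, hB, hBD, hB0, hstart⟩ := ih (by omega)
      have hmem : j + 1 ∈ Finset.Icc 1 (m0 + 1) := Finset.mem_Icc.2 ⟨by omega, by omega⟩
      have hmem' : j + 1 + 1 ∈ Finset.Icc 1 (m0 + 1) := Finset.mem_Icc.2 ⟨by omega, by omega⟩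
      have h := seg (j + 1) hmem B hB hBD (by simpa using hstart)
      refine ⟨D, hD0.le, le_rfl, fun h => by omega, fun w => (h w).trans ?_⟩
      simp only [Nat.add_sub_cancel]
      have hdec : ρ * ((1 - x ^ 2) ^ (br (j + 1) - br j) * B) ≤ D / 2 := by
        rcases Nat.eq_zero_or_pos j with hj0 | hj0
        · rw [hB0 hj0]
          simp only [mul_zero]
          positivity
        · have hg := hgap j hj0 (by omega)
          have : (1 - x ^ 2) ^ (br (j + 1) - br j) ≤ (1 - x ^ 2) ^ L :=
            pow_le_pow_of_le_one hτ0 hτ1 (by omega)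
          calc ρ * ((1 - x ^ 2) ^ (br (j + 1) - br j) * B)
              ≤ ρ * ((1 - x ^ 2) ^ L * D) := by gcongr
            _ = ρ * (1 - x ^ 2) ^ L * D := by ring
            _ ≤ 1 / 2 * D := by gcongr
            _ = D / 2 := by ring
      have hVV := hcomp _ hmem _ hmem' w
      have hV' := hV0 _ hmem' w
      have hmul : (A + (1 - x ^ 2) ^ (br (j + 1) - br j) * B) * V (j + 1) w
          ≤ (A + D) * V (j + 1 + 1) w := by
        calc (A + (1 - x ^ 2) ^ (br (j + 1) - br j) * B) * V (j + 1) w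
            ≤ (A + (1 - x ^ 2) ^ (br (j + 1) - br j) * B) * (ρ * V (j + 1 + 1) w) := by gcongr
          _ = (ρ * A + ρ * ((1 - x ^ 2) ^ (br (j + 1) - br j) * B)) * V (j + 1 + 1) w := by ring
          _ ≤ (A + D) * V (j + 1 + 1) w := by
            refine mul_le_mul_of_nonneg_right ?_ hV'
            linarith
      linarith
  obtain ⟨B, hB, hBD, -, hstart⟩ := main m0 le_rfl
  have hmem : m0 + 1 ∈ Finset.Icc 1 (m0 + 1) := Finset.mem_Icc.2 ⟨by omega, le_rfl⟩
  have h := seg (m0 + 1) hmem B hB hBD (by simpa using hstart) 0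
  have hVz : V (m0 + 1) 0 = 0 := by
    refine le_antisymm ?_ (hV0 _ hmem 0)
    simpa using he _ hmem 0
  rw [hVz, mul_zero, zero_add] at h
  exact h

end Propagation

/-! ### Break points and segments -/

namespace Model

variable {p q T : ℕ} (M : Model p q T)

lemma br_mono {i j : ℕ} (hij : i ≤ j) (hj : j ≤ M.m0 + 1) : M.br i ≤ M.br j := by
  induction j, hij using Nat.le_induction with
  | base => exact le_rfl
  | succ j _ ih => exact (ih (by omega)).trans (M.br_lt j (by omega)).le

/-- `seg t` is the index of the segment that contains the time `t`. -/
lemma seg_spec {t : ℕ} (ht : t ≤ T) :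
    M.seg t ∈ M.segments ∧ M.br (M.seg t - 1) ≤ t ∧ t < M.br (M.seg t) := by
  have hex : ∃ j, t < M.br j ∧ j ≤ M.m0 + 1 := ⟨M.m0 + 1, by rw [M.br_last]; omega, le_rfl⟩
  classical
  obtain ⟨hj1, hj2⟩ := Nat.find_spec hex
  set j := Nat.find hex with hj
  have hmin : ∀ i < j, M.br i ≤ t := fun i hi => by
    have := Nat.find_min hex (m := i) hi
    by_contra h
    exact this ⟨by omega, by omega⟩
  have hj0 : j ≠ 0 := by
    intro h
    rw [h, M.br_zero] at hj1
    omega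
  have hfilter : (Finset.Icc 1 M.m0).filter (fun i => M.br i ≤ t) = Finset.Icc 1 (j - 1) := by
    ext i
    simp only [Finset.mem_filter, Finset.mem_Icc]
    constructor
    · rintro ⟨⟨h1, h2⟩, h3⟩
      refine ⟨h1, ?_⟩
      by_contra h
      have := M.br_mono (i := j) (j := i) (by omega) (by omega)
      omega
    · rintro ⟨h1, h2⟩
      exact ⟨⟨h1, by omega⟩, hmin i (by omega)⟩
  have hseg : M.seg t = j := by
    rw [seg, hfilter, Nat.card_Icc]
    omega
  rw [hseg]
  refine ⟨Finset.mem_Icc.2 ⟨by omega, hj2⟩, hmin _ (by omega), hj1⟩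

lemma one_mem_segments : 1 ∈ M.segments := Finset.mem_Icc.2 ⟨le_rfl, by omega⟩

end Model

/-! ### The observed process is a linear functional of the first stationary process -/

section Observed

variable {Ω : Type*} [mΩ : MeasurableSpace Ω] {P : Measure Ω} [IsProbabilityMeasure P]
  {p q T : ℕ}

/-- As `Sig` is invertible, the noise can be recovered from the process. -/
lemma IsStationaryGaussianVAR.linPast_noise {Φ : Matrix (Fin p) (Fin q × Fin p) ℝ}
    {Sig : Matrix (Fin p) (Fin p) ℝ} {ε Y : ℤ → Ω → Fin p → ℝ}
    (hY : IsStationaryGaussianVAR P Φ Sig ε Y) (hε : IsGaussianWhiteNoise P ε)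
    (hSig : Sig.PosSemidef) {a b : ℝ} (ha : 0 < a) (hs : SpectrumBetween (autocov P Y) a b)
    (t : ℤ) (k : Fin p) : LinPast P Y (t + 1) (fun ω => ε t ω k) := by
  have hinj : Function.Injective (psdSqrt Sig).mulVec := by
    intro x z hxz
    have h0 : psdSqrt Sig *ᵥ (x - z) = 0 := by
      rw [Matrix.mulVec_sub, sub_eq_zero]
      exact hxz
    have h1 := hY.le_form_Sig hε hSig ha.le hs (x - z)
    rw [← sqNorm_psdSqrt_mulVec hSig, h0] at h1
    have h2 : sqNorm (0 : Fin p → ℝ) = 0 := by simp [sqNorm]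
    rw [h2] at h1
    have hπ := Real.pi_pos
    have h3 : sqNorm (x - z) ≤ 0 := nonpos_of_mul_nonpos_right h1 (by positivity)
    ext i
    have h4 : (x - z) i ^ 2 ≤ sqNorm (x - z) :=
      Finset.single_le_sum (f := fun i => (x - z) i ^ 2) (fun _ _ => sq_nonneg _)
        (Finset.mem_univ i)
    have h5 : (x - z) i = 0 := by
      rw [← sq_eq_zero_iff]
      exact le_antisymm (h4.trans h3) (sq_nonneg _)
    simpa [sub_eq_zero] using h5
  have hunit : IsUnit (psdSqrt Sig) := Matrix.mulVec_injective_iff_isUnit.1 hinj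
  have hdet : IsUnit (psdSqrt Sig).det := (Matrix.isUnit_iff_isUnit_det _).1 hunit
  have hlin : LinPast P Y (t + 1)
      (fun ω => (psdSqrt Sig)⁻¹ k ⬝ᵥ (Y t ω - Φ *ᵥ lagVec q (fun s => Y s ω) t)) := by
    refine LinPast.dotProduct _ fun i => ?_
    exact (LinPast.of_lt (lt_add_one t) i).sub
      ((linPast_dotProduct_lagVec Y t (Φ i)).mono (by omega))
  refine hlin.congr ?_
  filter_upwards [hY.recursion t] with ω hω
  have : Y t ω - Φ *ᵥ lagVec q (fun s => Y s ω) t = psdSqrt Sig *ᵥ ε t ω := by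
    rw [hω]
    simp
  rw [this]
  change _ = ((psdSqrt Sig)⁻¹ *ᵥ (psdSqrt Sig *ᵥ ε t ω)) k
  rw [Matrix.mulVec_mulVec, Matrix.nonsing_inv_mul _ hdet, Matrix.one_mulVec]

variable {M : Model p q T} {ε : ℤ → Ω → Fin p → ℝ} {Y : ℕ → ℤ → Ω → Fin p → ℝ}
  {y : ℤ → Ω → Fin p → ℝ} {a b : ℝ}

/-- The recursion carries the observed process past the first break point, driven by noise that is
itself a linear functional of the first stationary process. -/
lemma Model.IsPath.linPast (hy : M.IsPath P ε Y y) (hε : IsGaussianWhiteNoise P ε)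
    (ha : 0 < a) (hA : StationaritySpectrum M P ε Y a b) {t : ℤ} (ht : t ≤ T) (k : Fin p) :
    LinPast P (Y 1) (t + 1) (fun ω => y t ω k) := by
  have hinit : ∀ t : ℤ, t < M.br 1 → ∀ k, LinPast P (Y 1) (t + 1) (fun ω => y t ω k) := by
    intro t ht k
    refine (LinPast.of_lt (lt_add_one t) k).congr ?_
    filter_upwards [hy.init t ht] with ω hω
    rw [hω]
  obtain ⟨hY, hs⟩ := hA 1 M.one_mem_segments
  have hnat : ∀ t : ℕ, t ≤ T → ∀ k, LinPast P (Y 1) ((t : ℤ) + 1) (fun ω => y t ω k) := by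
    intro t
    induction t using Nat.strong_induction_on with
    | _ t ih =>
      intro ht k
      obtain ⟨hj, h1, h2⟩ := M.seg_spec ht
      have hpast : ∀ lc : Fin q × Fin p, LinPast P (Y 1) ((t : ℤ) + 1)
          (fun ω => lagVec q (fun s => y s ω) t lc) := by
        intro lc
        rcases lt_or_ge ((t : ℤ) - 1 - lc.1) (M.br 1) with h | h
        · exact (hinit _ h lc.2).mono (by omega)
        · obtain ⟨s, hs⟩ : ∃ s : ℕ, (t : ℤ) - 1 - lc.1 = s :=
            ⟨((t : ℤ) - 1 - lc.1).toNat, by omega⟩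
          have := ih s (by omega) (by omega) lc.2
          simp only [lagVec, hs]
          exact this.mono (by omega)
      have hlin := (LinPast.dotProduct (M.Φ (M.seg t) k) hpast).add
        (LinPast.dotProduct (psdSqrt (M.Sig (M.seg t)) k)
          fun i => hY.linPast_noise hε (M.Sig_psd 1) ha hs t i)
      refine hlin.congr ?_
      filter_upwards [hy.recursion _ hj t (by exact_mod_cast h1) (by exact_mod_cast h2)] with ω hω
      rw [hω]
      rfl
  rcases lt_or_ge t (M.br 1) with h | h
  · exact hinit t h k
  · obtain ⟨s, rfl⟩ : ∃ s : ℕ, t = s := ⟨t.toNat, by omega⟩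
    exact hnat s (by omega) k

lemma Model.IsPath.linPast_lagVec (hy : M.IsPath P ε Y y) (hε : IsGaussianWhiteNoise P ε)
    (ha : 0 < a) (hA : StationaritySpectrum M P ε Y a b) {t : ℤ} (ht : t ≤ T + 1)
    (lc : Fin q × Fin p) : LinPast P (Y 1) t (fun ω => lagVec q (fun s => y s ω) t lc) :=
  (hy.linPast hε ha hA (t := t - 1 - lc.1) (by omega) lc.2).mono (by omega)

end Observed

/-! ### Variance of linear functionals of the observed process -/

section Variance

lemma variance_add_le {Ω : Type*} [MeasurableSpace Ω] {P : Measure Ω} [IsFiniteMeasure P]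
    {f g : Ω → ℝ} (hf : MemLp f 2 P) (hg : MemLp g 2 P) {δ : ℝ} (hδ : 0 < δ) :
    Var[fun ω => f ω + g ω; P] ≤ (1 + δ) * Var[f; P] + (1 + 1 / δ) * Var[g; P] := by
  rw [variance_fun_add hf hg]
  have h := variance_nonneg (fun ω => δ * f ω - g ω) P
  rw [variance_fun_sub (hf.const_mul δ) hg, variance_const_mul, covariance_const_mul_left] at h
  have h2 : 2 * cov[f, g; P] ≤ δ * Var[f; P] + 1 / δ * Var[g; P] := by
    have : 2 * cov[f, g; P]
        = δ * Var[f; P] + 1 / δ * Var[g; P]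
          - 1 / δ * (δ ^ 2 * Var[f; P] - 2 * (δ * cov[f, g; P]) + Var[g; P]) := by
      field_simp
      ring
    rw [this]
    have : 0 ≤ 1 / δ * (δ ^ 2 * Var[f; P] - 2 * (δ * cov[f, g; P]) + Var[g; P]) := by positivity
    linarith
  linarith

lemma SpectrumBetween.le {p : ℕ} {Γ : ℤ → Matrix (Fin p) (Fin p) ℝ} {a b : ℝ}
    (h : SpectrumBetween Γ a b) (hp : 0 < p) : a ≤ b := by
  have h1 := h.autocovForm_bounds {0} fun _ => Pi.single ⟨0, hp⟩ 1
  have h2 := h1.1.trans h1.2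
  have h3 : sqNorm (Pi.single (⟨0, hp⟩ : Fin p) (1 : ℝ)) = 1 := by
    rw [sqNorm_eq_dotProduct]
    simp
  simp only [Finset.sum_singleton, h3, mul_one] at h2
  have := Real.pi_pos
  exact le_of_mul_le_mul_left h2 (by positivity)

universe u

/-- The covariance operator of the observations of one component is bounded, with a bound that
depends on the order and on the spectral bounds only, if the segments are long enough. -/
lemma exists_variance_bound (q : ℕ) [NeZero q] {a b : ℝ} (ha : 0 < a) (hab : a ≤ b) :
    ∃ K > 0, ∃ L : ℕ, ∀ {p T : ℕ} {M : Model p q T} {Ω : Type u} [MeasurableSpace Ω]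
      {P : Measure Ω} [IsProbabilityMeasure P] {ε : ℤ → Ω → Fin p → ℝ}
      {Y : ℕ → ℤ → Ω → Fin p → ℝ} {y : ℤ → Ω → Fin p → ℝ},
      M.IsPath P ε Y y → IsGaussianWhiteNoise P ε → StationaritySpectrum M P ε Y a b →
      (∀ j, 1 ≤ j → j < M.m0 → M.br j + L ≤ M.br (j + 1)) → ∀ (c : Fin p) (g : ℕ → ℝ),
      Var[fun ω => ∑ s ∈ Finset.range (T + 1), g s * y s ω c; P]
        ≤ K * ∑ s ∈ Finset.range (T + 1), g s ^ 2 := by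
  have hb : 0 < b := ha.trans_le hab
  have hq : 0 < q := Nat.pos_of_ne_zero (NeZero.ne q)
  have hq' : (1 : ℝ) ≤ q := by exact_mod_cast hq
  have hπ := Real.pi_pos
  -- Bernoulli's inequality turns the contraction `1 - a / b` in `q` steps into `1 - x` per step
  set x : ℝ := a / (2 * b * q) with hx
  have hx0 : 0 < x := by positivity
  have hx1 : x ≤ 1 / 2 := by
    rw [hx, div_le_div_iff₀ (by positivity) (by norm_num)]
    nlinarith
  have hθ0 : 0 < 1 - x := by linarith
  have hθq : 1 - a / b ≤ (1 - x) ^ q := by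
    have h1 := one_add_mul_le_pow (a := -x) (by linarith) q
    have h2 : (q : ℝ) * x = a / b / 2 := by
      rw [hx]
      field_simp
    have h3 : 0 < a / b := by positivity
    rw [← sub_eq_add_neg] at h1
    nlinarith
  set σ : ℝ := q * (1 - x)⁻¹ ^ q with hσ
  have hσ1 : 1 ≤ σ := by
    have : 1 ≤ (1 - x)⁻¹ ^ q := one_le_pow₀ ((one_le_inv₀ hθ0).2 (by linarith))
    nlinarith
  set κ : ℝ := σ * (2 * Real.pi * b) with hκ
  have hκ0 : 0 < κ := by positivity
  set ρ : ℝ := σ * (b / a) with hρ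
  have hρ1 : 1 ≤ ρ := by
    have : 1 ≤ b / a := (one_le_div ha).2 hab
    nlinarith
  set A : ℝ := (1 + x) / x ^ 2 with hA
  have hA0 : 0 < A := by positivity
  obtain ⟨L, hL⟩ : ∃ L : ℕ, ρ * (1 - x ^ 2) ^ L ≤ 1 / 2 := by
    obtain ⟨L, hL⟩ := exists_pow_lt_of_lt_one (show 0 < 1 / (2 * ρ) by positivity)
      (show 1 - x ^ 2 < 1 by nlinarith)
    refine ⟨L, ?_⟩
    calc ρ * (1 - x ^ 2) ^ L ≤ ρ * (1 / (2 * ρ)) := by gcongr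
      _ = 1 / 2 := by field_simp
  refine ⟨(A + 2 * ρ * A + 1) * (1 + 1 / x) * κ, by positivity, L, ?_⟩
  intro p T M Ω _ P _ ε Y y hy hε hA1 hgap c g
  obtain ⟨hY1, hs1⟩ := hA1 1 M.one_mem_segments
  let e : Fin q × Fin p → ℝ := Pi.single (0, c) 1
  -- the weighted observations before time `t`, plus a functional of the regressors at time `t`
  let W : ℕ → (Fin q × Fin p → ℝ) → ℝ := fun t w =>
    Var[fun ω => ∑ s ∈ Finset.range t, g s * y s ω c
      + w ⬝ᵥ lagVec q (fun s => y s ω) (t : ℤ); P]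
  have hpos : ∀ j, ∀ w : Fin q × Fin p → ℝ, 0 ≤ lagForm P (Y j) w := fun j w =>
    variance_nonneg _ _
  have hVΓ : ∀ j ∈ M.segments, ∀ w, lyapunov (lagForm P (Y j)) (dualStep (M.Φ j)) (1 - x) q w
      ≤ σ * lagForm P (Y j) w := fun j hj w =>
    lyapunov_le hθ0 (by linarith) (hpos j)
      ((hA1 j hj).1.lagForm_dualStep_le hε (M.Sig_psd j)) w
  have hΓV : ∀ j, ∀ w, lagForm P (Y j) w
      ≤ lyapunov (lagForm P (Y j)) (dualStep (M.Φ j)) (1 - x) q w := fun j w =>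
    le_lyapunov hθ0 (hpos j) hq w
  have hVκ : ∀ j ∈ M.segments, ∀ w, lyapunov (lagForm P (Y j)) (dualStep (M.Φ j)) (1 - x) q w
      ≤ κ * sqNorm w := fun j hj w => (hVΓ j hj w).trans (by
        have := mul_le_mul_of_nonneg_left ((hA1 j hj).1.lagForm_bounds (hA1 j hj).2 w).2
          (show 0 ≤ σ by linarith)
        rw [hκ]
        linarith)
  have hmain := multisegment_bound (m0 := M.m0) (L := L) (br := M.br) M.br_zero M.br_lt hgap
    (V := fun j => lyapunov (lagForm P (Y j)) (dualStep (M.Φ j)) (1 - x) q)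
    (N := fun j w => headVec w ⬝ᵥ (M.Sig j *ᵥ headVec w)) (T := fun j => dualStep (M.Φ j))
    (W := W) (g := g) (e := e) hx0 (by linarith) hκ0.le hρ1 hA hL
    (fun j _ w => (hpos j w).trans (hΓV j w))
    (fun j hj u w => lyapunov_add_le hθ0 (dualStep_add _) (fun u w => by
      have := variance_add_le
        ((linPast_dotProduct_lagVec (P := P) (Y j) 0 u).hasGaussianLaw
          (hA1 j hj).1.gaussian).memLp_two
        ((linPast_dotProduct_lagVec (P := P) (Y j) 0 w).hasGaussianLaw
          (hA1 j hj).1.gaussian).memLp_two hx0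
      simpa only [lagForm, add_dotProduct] using this) u w)
    (fun j hj w => lyapunov_step_le hθ0 (fun w =>
      ((hA1 j hj).1.lagForm_iterate_le hε (M.Sig_psd j) ha hb (hA1 j hj).2 w).trans
        (mul_le_mul_of_nonneg_right hθq (hpos j w))) w)
    (fun j hj w => by
      refine le_trans ?_ (hΓV j w)
      rw [(hA1 j hj).1.lagForm_eq hε (M.Sig_psd j) w]
      exact le_add_of_nonneg_left (hpos j _))
    (fun j hj r => by
      refine (hVκ j hj _).trans_eq ?_
      have : sqNorm (r • e) = r ^ 2 := by
        rw [sqNorm_eq_dotProduct]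
        simp [e, dotProduct_smul, pow_two]
      rw [this])
    (fun j hj i hi w => by
      refine (hVκ j hj w).trans ?_
      have h1 := ((hA1 i hi).1.lagForm_bounds (hA1 i hi).2 w).1.trans (hΓV i w)
      calc κ * sqNorm w = ρ * (2 * Real.pi * a * sqNorm w) := by
            rw [hκ, hρ]
            field_simp
        _ ≤ _ := by gcongr)
    ?_ ?_
  · have hW0 : W (M.br (M.m0 + 1)) 0
        = Var[fun ω => ∑ s ∈ Finset.range (T + 1), g s * y s ω c; P] := by
      simp only [W, M.br_last, zero_dotProduct, add_zero]
    rw [← hW0, ← M.br_last]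
    exact hmain
  · intro j hj t ht1 ht2 w
    have htT : t ≤ T := by
      have := M.br_mono (Finset.mem_Icc.1 hj).2 le_rfl
      rw [M.br_last] at this
      omega
    set w' := w + g t • e with hw'
    have hlin : LinPast P (Y 1) (t : ℤ) (fun ω => ∑ s ∈ Finset.range t, g s * y s ω c
        + dualStep (M.Φ j) w' ⬝ᵥ lagVec q (fun s => y s ω) (t : ℤ)) := by
      refine LinPast.add (LinPast.sum _ fun s hs => LinPast.const_mul ?_ _)
        (LinPast.dotProduct _ fun lc => hy.linPast_lagVec hε ha hA1 (by omega) lc)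
      have hst := Finset.mem_range.1 hs
      exact (hy.linPast hε ha hA1 (t := s) (by omega) c).mono (by omega)
    have hvar := variance_linPast_add_noise hY1.gaussian hε (hY1.causal t) hlin
      (M.Sig_psd j) (headVec w')
    rw [← hvar]
    refine variance_congr ?_
    filter_upwards [hy.recursion j hj t (by exact_mod_cast ht1) (by exact_mod_cast ht2)] with ω hω
    have h1 : ((t + 1 : ℕ) : ℤ) = (t : ℤ) + 1 := by push_cast; ring
    have h2 : w ⬝ᵥ lagVec q (fun s => y s ω) ((t : ℤ) + 1) + g t * y t ω c
        = w' ⬝ᵥ lagVec q (fun s => y s ω) ((t : ℤ) + 1) := by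
      simp [hw', e, add_dotProduct, smul_dotProduct, lagVec]
    have h3 := dotProduct_lagVec_succ (M.Φ j) w' (fun s => y s ω) t
    have h4 : y t ω - M.Φ j *ᵥ lagVec q (fun s => y s ω) t = psdSqrt (M.Sig j) *ᵥ ε t ω := by
      rw [sub_eq_iff_eq_add, add_comm]
      exact hω
    rw [h1, Finset.sum_range_succ, add_assoc, add_comm (g t * y t ω c), h2, h3, h4, add_assoc]
  · intro w
    refine le_trans (le_of_eq ?_) (hΓV 1 w)
    simp only [W, Finset.range_zero, Finset.sum_empty, zero_add, lagForm, Nat.cast_zero]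
    refine variance_congr ?_
    have hbr : M.br 0 < M.br 1 := M.br_lt 0 (by omega)
    have hall : ∀ᵐ ω ∂P, ∀ l : Fin q, y (0 - 1 - (l : ℤ)) ω = Y 1 (0 - 1 - (l : ℤ)) ω :=
      ae_all_iff.2 fun l => hy.init _ (by omega)
    filter_upwards [hall] with ω hω
    simp only [dotProduct, lagVec, hω]

end Variance

/-! ### Exponential moments of sums of squares -/

section Squares

lemma lintegral_exp_mul_gaussianReal (v : NNReal) (s : ℝ) :
    ∫⁻ x, ENNReal.ofReal (Real.exp (s * x)) ∂(gaussianReal 0 v)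
      = ENNReal.ofReal (Real.exp (v * s ^ 2 / 2)) := by
  rw [← ofReal_integral_eq_lintegral_ofReal (integrable_exp_mul_gaussianReal s)
    (ae_of_all _ fun _ => (Real.exp_pos _).le)]
  have := congrFun (mgf_id_gaussianReal (μ := 0) (v := v)) s
  simp only [mgf, id, zero_mul, zero_add] at this
  rw [this]

lemma lintegral_exp_sq_gaussianReal :
    ∫⁻ x, ENNReal.ofReal (Real.exp (x ^ 2 / 4)) ∂(gaussianReal 0 1) = ENNReal.ofReal (√2) := by
  have hπ := Real.pi_pos
  rw [gaussianReal_of_var_ne_zero 0 one_ne_zero,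
    lintegral_withDensity_eq_lintegral_mul _ (measurable_gaussianPDF 0 1) (by fun_prop)]
  have h1 : ∀ x : ℝ, (gaussianPDF 0 1 * fun x => ENNReal.ofReal (Real.exp (x ^ 2 / 4))) x
      = ENNReal.ofReal ((√(2 * Real.pi))⁻¹ * Real.exp (-(1 / 4) * x ^ 2)) := by
    intro x
    rw [Pi.mul_apply, gaussianPDF, ← ENNReal.ofReal_mul (gaussianPDFReal_nonneg _ _ _),
      gaussianPDFReal, mul_assoc, ← Real.exp_add]
    simp only [NNReal.coe_one, sub_zero, mul_one]
    congr 3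
    ring
  simp_rw [h1]
  rw [← ofReal_integral_eq_lintegral_ofReal
    ((integrable_exp_neg_mul_sq (by norm_num : (0 : ℝ) < 1 / 4)).const_mul _)
    (ae_of_all _ fun _ => by positivity), integral_const_mul, integral_gaussian]
  congr 1
  rw [← Real.sqrt_inv, ← Real.sqrt_mul (by positivity)]
  congr 1
  field_simp
  norm_num

variable {Ω : Type*} [MeasurableSpace Ω] {P : Measure Ω} [IsProbabilityMeasure P]

/-- A vector whose linear functionals have the moment generating functions of Gaussian variables
with covariance operator at most `K` has Gaussian-type exponential moments of its squared norm:
the exponential of the square is itself a Gaussian average of exponentials of linear functionals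
(the Hubbard–Stratonovich transformation). -/
lemma lintegral_exp_sum_sq_le {N : ℕ} {X : Fin N → Ω → ℝ} (hX : ∀ i, AEMeasurable (X i) P)
    {K : ℝ} (hK : 0 < K)
    (h : ∀ g : Fin N → ℝ, ∫⁻ ω, ENNReal.ofReal (Real.exp (∑ i, g i * X i ω)) ∂P
      ≤ ENNReal.ofReal (Real.exp (K * (∑ i, g i ^ 2) / 2))) :
    ∫⁻ ω, ENNReal.ofReal (Real.exp ((∑ i, X i ω ^ 2) / (4 * K))) ∂P
      ≤ ENNReal.ofReal (√2) ^ N := by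
  set r : ℝ := √(1 / (2 * K)) with hr
  have hr2 : r ^ 2 = 1 / (2 * K) := Real.sq_sqrt (by positivity)
  let γ : Measure (Fin N → ℝ) := Measure.pi fun _ => gaussianReal 0 1
  have hprod : ∀ f : Fin N → ℝ → ENNReal, (∀ i, Measurable (f i)) →
      ∫⁻ g, ∏ i, f i (g i) ∂γ = ∏ i, ∫⁻ x, f i x ∂(gaussianReal 0 1) := by
    intro f hf
    have hind : iIndepFun (fun (i : Fin N) (g : Fin N → ℝ) => f i (g i)) γ :=
      iIndepFun_pi fun i => (hf i).aemeasurable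
    rw [lintegral_prod_eq_prod_lintegral_of_indepFun Finset.univ _ hind
      fun i => (hf i).comp (measurable_pi_apply i)]
    refine Finset.prod_congr rfl fun i _ => ?_
    exact (measurePreserving_eval (fun _ : Fin N => gaussianReal 0 1) i).lintegral_comp (hf i)
  have hexp : ∀ (f : Fin N → ℝ), ENNReal.ofReal (Real.exp (∑ i, f i))
      = ∏ i, ENNReal.ofReal (Real.exp (f i)) := fun f => by
    rw [Real.exp_sum, ENNReal.ofReal_prod_of_nonneg fun _ _ => (Real.exp_pos _).le]
  have h1 : ∀ ω, ENNReal.ofReal (Real.exp ((∑ i, X i ω ^ 2) / (4 * K)))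
      = ∫⁻ g, ENNReal.ofReal (Real.exp (∑ i, (r * g i) * X i ω)) ∂γ := by
    intro ω
    simp_rw [hexp]
    rw [hprod (fun i x => ENNReal.ofReal (Real.exp (r * x * X i ω))) fun i => by fun_prop,
      Finset.sum_div, hexp]
    refine Finset.prod_congr rfl fun i _ => ?_
    have h2 : ∀ x, r * x * X i ω = (r * X i ω) * x := fun x => by ring
    simp_rw [h2, lintegral_exp_mul_gaussianReal, mul_pow, hr2]
    congr 2
    simp only [NNReal.coe_one]
    field_simp
    norm_num
  simp_rw [h1]
  rw [lintegral_lintegral_swap]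
  · calc ∫⁻ g, ∫⁻ ω, ENNReal.ofReal (Real.exp (∑ i, (r * g i) * X i ω)) ∂P ∂γ
        ≤ ∫⁻ g, ∏ i, ENNReal.ofReal (Real.exp (g i ^ 2 / 4)) ∂γ := by
          refine lintegral_mono fun g => (h fun i => r * g i).trans_eq ?_
          rw [← hexp]
          congr 2
          simp_rw [mul_pow, hr2]
          rw [← Finset.mul_sum, ← Finset.sum_div]
          field_simp
          ring
      _ = ENNReal.ofReal (√2) ^ N := by
          rw [hprod (fun _ x => ENNReal.ofReal (Real.exp (x ^ 2 / 4))) fun i => by fun_prop]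
          simp [lintegral_exp_sq_gaussianReal]
  · have : ∀ i, AEMeasurable (fun z : Ω × (Fin N → ℝ) => r * z.2 i * X i z.1) (P.prod γ) :=
      fun i => (show Measurable fun z : Ω × (Fin N → ℝ) => r * z.2 i by fun_prop).aemeasurable.mul
        (hX i).comp_fst
    exact (Real.measurable_exp.comp_aemeasurable
      (Finset.aemeasurable_fun_sum _ fun i _ => this i)).ennreal_ofReal

/-- Under the assumptions of `lintegral_exp_sum_sq_le`, the sum of squares exceeds `8 K N` with an
exponentially small probability only. -/
lemma measure_sum_sq_ge_le {N : ℕ} {X : Fin N → Ω → ℝ} (hX : ∀ i, AEMeasurable (X i) P)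
    {K : ℝ} (hK : 0 < K)
    (h : ∀ g : Fin N → ℝ, ∫⁻ ω, ENNReal.ofReal (Real.exp (∑ i, g i * X i ω)) ∂P
      ≤ ENNReal.ofReal (Real.exp (K * (∑ i, g i ^ 2) / 2))) :
    P {ω | 8 * K * N ≤ ∑ i, X i ω ^ 2} ≤ ENNReal.ofReal (Real.exp (-N)) := by
  have hm : AEMeasurable (fun ω => ENNReal.ofReal (Real.exp ((∑ i, X i ω ^ 2) / (4 * K)))) P :=
    (Real.measurable_exp.comp_aemeasurable ((Finset.aemeasurable_fun_sum _ fun i _ =>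
      (hX i).pow_const 2).div_const _)).ennreal_ofReal
  have h1 := (mul_meas_ge_le_lintegral₀ hm (ENNReal.ofReal (Real.exp (2 * N)))).trans
    (lintegral_exp_sum_sq_le hX hK h)
  have h2 : {ω | 8 * K * N ≤ ∑ i, X i ω ^ 2} ⊆ {ω | ENNReal.ofReal (Real.exp (2 * N))
      ≤ ENNReal.ofReal (Real.exp ((∑ i, X i ω ^ 2) / (4 * K)))} := by
    intro ω hω
    refine ENNReal.ofReal_le_ofReal (Real.exp_le_exp.2 ?_)
    rw [le_div_iff₀ (by positivity)]
    calc 2 * N * (4 * K) = 8 * K * N := by ring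
      _ ≤ _ := hω
  have h3 : ENNReal.ofReal (√2) ^ N ≤ ENNReal.ofReal (Real.exp N) := by
    rw [← ENNReal.ofReal_pow (Real.sqrt_nonneg _)]
    refine ENNReal.ofReal_le_ofReal ?_
    rw [← Real.exp_one_pow]
    refine pow_le_pow_left₀ (Real.sqrt_nonneg _) ?_ _
    have h4 : √2 ≤ 2 := Real.sqrt_le_iff.2 ⟨by norm_num, by norm_num⟩
    have h5 := Real.add_one_le_exp 1
    linarith
  calc P {ω | 8 * K * N ≤ ∑ i, X i ω ^ 2}
      = ENNReal.ofReal (Real.exp (-(2 * N))) * (ENNReal.ofReal (Real.exp (2 * N))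
          * P {ω | 8 * K * N ≤ ∑ i, X i ω ^ 2}) := by
        rw [← mul_assoc, ← ENNReal.ofReal_mul (Real.exp_pos _).le, ← Real.exp_add]
        simp
    _ ≤ ENNReal.ofReal (Real.exp (-(2 * N))) * ENNReal.ofReal (Real.exp N) := by
        gcongr
        exact ((mul_le_mul_right (measure_mono h2) _).trans h1).trans h3
    _ = ENNReal.ofReal (Real.exp (-N)) := by
        rw [← ENNReal.ofReal_mul (Real.exp_pos _).le, ← Real.exp_add]
        congr 2
        ring

end Squares

/-! ### The exponential supermartingale of a sum of predictable multiples of the noise -/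

section Martingale

variable {Ω : Type*} [mΩ : MeasurableSpace Ω] {P : Measure Ω} [IsProbabilityMeasure P] {p : ℕ}
  {ε Y : ℤ → Ω → Fin p → ℝ}

lemma lintegral_exp_add_mul_noise (hYm : ∀ t, Measurable (Y t)) (hε : IsGaussianWhiteNoise P ε)
    {t : ℤ} (hc : IndepFun (fun ω (s : Set.Iio t) => Y s ω) (ε t) P) {B x : Ω → ℝ}
    (hB : AEStronglyMeasurable[pastSigma Y t] B P) (hx : AEStronglyMeasurable[pastSigma Y t] x P)
    {A : Matrix (Fin p) (Fin p) ℝ} (hA : A.PosSemidef) (u : Fin p → ℝ) :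
    ∫⁻ ω, ENNReal.ofReal (Real.exp (B ω + x ω * (u ⬝ᵥ (psdSqrt A *ᵥ ε t ω)))) ∂P
      = ∫⁻ ω, ENNReal.ofReal (Real.exp (B ω + (u ⬝ᵥ (A *ᵥ u)) * x ω ^ 2 / 2)) ∂P := by
  set η : Ω → ℝ := fun ω => u ⬝ᵥ (psdSqrt A *ᵥ ε t ω) with hη
  have hpair : AEStronglyMeasurable[pastSigma Y t] (fun ω => (B ω, x ω)) P := hB.prodMk hx
  have hind : IndepFun (fun ω => (B ω, x ω)) η P :=
    indepFun_of_past hc hpair (φ := fun z => u ⬝ᵥ (psdSqrt A *ᵥ z)) (by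
      simp only [dotProduct, Matrix.mulVec]
      fun_prop)
  have hpm : AEMeasurable (fun ω => (B ω, x ω)) P :=
    (hpair.mono (pastSigma_le hYm t)).aemeasurable
  have hηm : AEMeasurable η P := (hε.hasGaussianLaw_noise hA t u).aemeasurable
  have hlaw : P.map η = gaussianReal 0 (u ⬝ᵥ (A *ᵥ u)).toNNReal := hε.hasLaw_noise hA t u
  let F : (ℝ × ℝ) × ℝ → ENNReal := fun z => ENNReal.ofReal (Real.exp (z.1.1 + z.1.2 * z.2))
  have hF : Measurable F := by fun_prop
  have h1 : ∫⁻ ω, ENNReal.ofReal (Real.exp (B ω + x ω * η ω)) ∂P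
      = ∫⁻ z, F z ∂(P.map fun ω => ((B ω, x ω), η ω)) := by
    rw [lintegral_map' hF.aemeasurable (hpm.prodMk hηm)]
  rw [h1, (indepFun_iff_map_prod_eq_prod_map_map hpm hηm).1 hind, hlaw,
    lintegral_prod _ hF.aemeasurable, lintegral_map' (hF.lintegral_prod_right').aemeasurable hpm]
  refine lintegral_congr fun ω => ?_
  simp only [F, Real.exp_add, ENNReal.ofReal_mul (Real.exp_pos _).le]
  rw [lintegral_const_mul _ (by fun_prop), lintegral_exp_mul_gaussianReal,
    Real.coe_toNNReal _ (form_nonneg hA u)]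

lemma aestronglyMeasurable_sum_subalgebra {Ω ι : Type*} {m m₀ : MeasurableSpace Ω}
    {P : Measure[m₀] Ω} {s : Finset ι} {f : ι → Ω → ℝ}
    (hf : ∀ i ∈ s, AEStronglyMeasurable[m] (f i) P) :
    AEStronglyMeasurable[m] (fun ω => ∑ i ∈ s, f i ω) P := by
  classical
  induction s using Finset.induction_on with
  | empty => simpa using aestronglyMeasurable_const
  | insert i s hi ih =>
    simp only [Finset.sum_insert hi]
    exact (hf i (Finset.mem_insert_self i s)).add
      (ih fun j hj => hf j (Finset.mem_insert_of_mem hj))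

/-- The exponential martingale of `∑ x_r η_r` for predictable `x_r` and Gaussian noise `η_r`. -/
lemma lintegral_exp_martingale (hYm : ∀ t, Measurable (Y t)) (hε : IsGaussianWhiteNoise P ε)
    (hc : ∀ t, IndepFun (fun ω (s : Set.Iio t) => Y s ω) (ε t) P)
    (hpast : ∀ t k, LinPast P Y (t + 1) (fun ω => ε t ω k)) (t₀ : ℤ) {N : ℕ} {x : ℕ → Ω → ℝ}
    (hx : ∀ r < N, LinPast P Y (t₀ + r) (x r)) {A : ℕ → Matrix (Fin p) (Fin p) ℝ}
    (hA : ∀ r, (A r).PosSemidef) (u : Fin p → ℝ) (z : ℝ) :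
    ∫⁻ ω, ENNReal.ofReal (Real.exp (∑ r ∈ Finset.range N,
      (z * x r ω * (u ⬝ᵥ (psdSqrt (A r) *ᵥ ε (t₀ + r) ω))
        - (u ⬝ᵥ (A r *ᵥ u)) * (z * x r ω) ^ 2 / 2))) ∂P = 1 := by
  induction N with
  | zero => simp
  | succ N ih =>
    rw [← ih fun r hr => hx r (by omega)]
    set S : Ω → ℝ := fun ω => ∑ r ∈ Finset.range N,
      (z * x r ω * (u ⬝ᵥ (psdSqrt (A r) *ᵥ ε (t₀ + r) ω))
        - (u ⬝ᵥ (A r *ᵥ u)) * (z * x r ω) ^ 2 / 2) with hS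
    have hxm : ∀ r ≤ N, AEStronglyMeasurable[pastSigma Y (t₀ + N)] (x r) P := fun r hr =>
      ((hx r (by omega)).mono (by omega)).aestronglyMeasurable
    have hquad : ∀ f : Ω → ℝ, AEStronglyMeasurable[pastSigma Y (t₀ + N)] f P → ∀ c : ℝ,
        AEStronglyMeasurable[pastSigma Y (t₀ + N)] (fun ω => c * (z * f ω) ^ 2 / 2) P :=
      fun f hf c =>
        (show Continuous fun v : ℝ => c * (z * v) ^ 2 / 2 by fun_prop).comp_aestronglyMeasurable hf
    have hSm : AEStronglyMeasurable[pastSigma Y (t₀ + N)] S P := by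
      refine aestronglyMeasurable_sum_subalgebra fun r hr => ?_
      have hr' := Finset.mem_range.1 hr
      have h1 : AEStronglyMeasurable[pastSigma Y (t₀ + N)] (fun ω => z * x r ω) P :=
        (hxm r hr'.le).const_mul z
      have h2 : AEStronglyMeasurable[pastSigma Y (t₀ + N)]
          (fun ω => u ⬝ᵥ (psdSqrt (A r) *ᵥ ε (t₀ + r) ω)) P := by
        refine LinPast.aestronglyMeasurable ?_
        refine LinPast.dotProduct u fun i => ?_
        exact LinPast.dotProduct (psdSqrt (A r) i) fun k => (hpast _ k).mono (by omega)
      exact (h1.mul h2).sub (hquad _ (hxm r hr'.le) _)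
    have hBm : AEStronglyMeasurable[pastSigma Y (t₀ + N)]
        (fun ω => S ω - (u ⬝ᵥ (A N *ᵥ u)) * (z * x N ω) ^ 2 / 2) P :=
      hSm.sub (hquad _ (hxm N le_rfl) _)
    have h := lintegral_exp_add_mul_noise hYm hε (hc (t₀ + N)) hBm ((hxm N le_rfl).const_mul z)
      (hA N) u
    simp only [sub_add_cancel] at h
    rw [← h]
    refine lintegral_congr fun ω => ?_
    rw [Finset.sum_range_succ]
    congr 2
    simp only [hS]
    ring

/-- Bernstein-type inequality: a sum of predictable multiples of Gaussian noise is subgaussian on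
the event that its quadratic variation is bounded. -/
lemma measure_sum_mul_noise_ge_le (hYm : ∀ t, Measurable (Y t)) (hε : IsGaussianWhiteNoise P ε)
    (hc : ∀ t, IndepFun (fun ω (s : Set.Iio t) => Y s ω) (ε t) P)
    (hpast : ∀ t k, LinPast P Y (t + 1) (fun ω => ε t ω k)) (t₀ : ℤ) {N : ℕ} {x : ℕ → Ω → ℝ}
    (hx : ∀ r < N, LinPast P Y (t₀ + r) (x r)) {A : ℕ → Matrix (Fin p) (Fin p) ℝ}
    (hA : ∀ r, (A r).PosSemidef) (u : Fin p → ℝ) {s V : ℝ} (hV : 0 < V) (hs : 0 ≤ s) :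
    P {ω | s ≤ |∑ r ∈ Finset.range N, x r ω * (u ⬝ᵥ (psdSqrt (A r) *ᵥ ε (t₀ + r) ω))| ∧
        ∑ r ∈ Finset.range N, (u ⬝ᵥ (A r *ᵥ u)) * x r ω ^ 2 ≤ V}
      ≤ 2 * ENNReal.ofReal (Real.exp (-(s ^ 2 / (2 * V)))) := by
  set S : Ω → ℝ := fun ω =>
    ∑ r ∈ Finset.range N, x r ω * (u ⬝ᵥ (psdSqrt (A r) *ᵥ ε (t₀ + r) ω)) with hS
  set Q : Ω → ℝ := fun ω => ∑ r ∈ Finset.range N, (u ⬝ᵥ (A r *ᵥ u)) * x r ω ^ 2 with hQ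
  have hexp : ∀ z : ℝ, ∫⁻ ω, ENNReal.ofReal (Real.exp (z * S ω - z ^ 2 * Q ω / 2)) ∂P = 1 := by
    intro z
    rw [← lintegral_exp_martingale hYm hε hc hpast t₀ hx hA u z]
    refine lintegral_congr fun ω => ?_
    congr 2
    rw [Finset.sum_sub_distrib, ← Finset.sum_div, hS, hQ, Finset.mul_sum, Finset.mul_sum]
    congr 1
    · exact Finset.sum_congr rfl fun r _ => by ring
    · congr 1
      exact Finset.sum_congr rfl fun r _ => by ring
  have hxm : ∀ r < N, AEMeasurable (x r) P := fun r hr =>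
    ((hx r hr).aestronglyMeasurable.mono (pastSigma_le hYm _)).aemeasurable
  have hηm : ∀ r, AEMeasurable (fun ω => u ⬝ᵥ (psdSqrt (A r) *ᵥ ε (t₀ + r) ω)) P := fun r =>
    (hε.hasGaussianLaw_noise (hA r) _ u).aemeasurable
  have hSm : AEMeasurable S P := Finset.aemeasurable_fun_sum _ fun r hr =>
    (hxm r (Finset.mem_range.1 hr)).mul (hηm r)
  have hQm : AEMeasurable Q P := Finset.aemeasurable_fun_sum _ fun r hr =>
    ((hxm r (Finset.mem_range.1 hr)).pow_const 2).const_mul _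
  have key : ∀ z : ℝ, |z| = s / V → P {ω | |z| * s ≤ z * S ω ∧ Q ω ≤ V}
      ≤ ENNReal.ofReal (Real.exp (-(s ^ 2 / (2 * V)))) := by
    intro z hz
    have hm : AEMeasurable (fun ω => ENNReal.ofReal (Real.exp (z * S ω - z ^ 2 * Q ω / 2))) P :=
      (Real.measurable_exp.comp_aemeasurable
        ((hSm.const_mul z).sub ((hQm.const_mul _).div_const 2))).ennreal_ofReal
    have h1 := mul_meas_ge_le_lintegral₀ hm (ENNReal.ofReal (Real.exp (s ^ 2 / (2 * V))))
    rw [hexp] at h1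
    have h2 : {ω | |z| * s ≤ z * S ω ∧ Q ω ≤ V} ⊆ {ω | ENNReal.ofReal (Real.exp (s ^ 2 / (2 * V)))
        ≤ ENNReal.ofReal (Real.exp (z * S ω - z ^ 2 * Q ω / 2))} := by
      rintro ω ⟨hω1, hω2⟩
      refine ENNReal.ofReal_le_ofReal (Real.exp_le_exp.2 ?_)
      have h3 : z ^ 2 * Q ω ≤ z ^ 2 * V := by gcongr
      have h4 : z ^ 2 * V = s ^ 2 / V := by
        rw [← sq_abs, hz]
        field_simp
      have h5 : |z| * s = s ^ 2 / V := by
        rw [hz]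
        field_simp
      have h6 : s ^ 2 / (2 * V) = s ^ 2 / V / 2 := by
        field_simp
      linarith
    calc P {ω | |z| * s ≤ z * S ω ∧ Q ω ≤ V}
        = ENNReal.ofReal (Real.exp (-(s ^ 2 / (2 * V))))
          * (ENNReal.ofReal (Real.exp (s ^ 2 / (2 * V)))
            * P {ω | |z| * s ≤ z * S ω ∧ Q ω ≤ V}) := by
          rw [← mul_assoc, ← ENNReal.ofReal_mul (Real.exp_pos _).le, ← Real.exp_add]
          simp
      _ ≤ ENNReal.ofReal (Real.exp (-(s ^ 2 / (2 * V)))) * 1 := by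
          gcongr
          exact (mul_le_mul_right (measure_mono h2) _).trans h1
      _ = _ := mul_one _
  have hsV : 0 ≤ s / V := by positivity
  have hsub : {ω | s ≤ |S ω| ∧ Q ω ≤ V} ⊆ {ω | |s / V| * s ≤ s / V * S ω ∧ Q ω ≤ V}
      ∪ {ω | |-(s / V)| * s ≤ -(s / V) * S ω ∧ Q ω ≤ V} := by
    rintro ω ⟨h1, h2⟩
    rcases le_abs.1 h1 with h | h
    · left
      refine ⟨?_, h2⟩
      rw [abs_of_nonneg hsV]
      gcongr
    · right
      refine ⟨?_, h2⟩
      rw [abs_neg, abs_of_nonneg hsV, neg_mul, ← mul_neg]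
      gcongr
  calc P {ω | s ≤ |S ω| ∧ Q ω ≤ V} ≤ _ := measure_mono hsub
    _ ≤ _ := measure_union_le _ _
    _ ≤ _ := add_le_add (key _ (abs_of_nonneg hsV)) (key _ (by rw [abs_neg, abs_of_nonneg hsV]))
    _ = _ := (two_mul _).symm

end Martingale

/-! ### The basic inequality of the fused lasso -/

section Deterministic

variable {p n q : ℕ}

lemma bigTheta_midpoint (θ θ' : Fin n → Matrix (Fin p) (Fin q × Fin p) ℝ) :
    bigTheta (fun i => (1 / 2 : ℝ) • (θ i + θ' i))
      = (1 / 2 : ℝ) • (bigTheta θ + bigTheta θ') := by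
  ext ⟨k, ic⟩
  simp [bigTheta, Matrix.vec]
  rfl

lemma sqNorm_midpoint {ι : Type*} [Fintype ι] (Y u v : ι → ℝ) :
    sqNorm (Y - (1 / 2 : ℝ) • (u + v))
      = (sqNorm (Y - u) + sqNorm (Y - v)) / 2 - sqNorm (u - v) / 4 := by
  simp only [sqNorm, Pi.sub_apply, Pi.smul_apply, Pi.add_apply, smul_eq_mul]
  rw [← Finset.sum_add_distrib, Finset.sum_div, Finset.sum_div, ← Finset.sum_sub_distrib]
  exact Finset.sum_congr rfl fun i _ => by ring

lemma l1Norm_add_le {ι κ : Type*} [Fintype ι] [Fintype κ] (A B : Matrix ι κ ℝ) :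
    l1Norm (A + B) ≤ l1Norm A + l1Norm B := by
  simp only [l1Norm, ← Finset.sum_add_distrib]
  exact Finset.sum_le_sum fun i _ => Finset.sum_le_sum fun k _ => abs_add_le _ _

lemma l1Norm_smul {ι κ : Type*} [Fintype ι] [Fintype κ] (c : ℝ) (A : Matrix ι κ ℝ) :
    l1Norm (c • A) = |c| * l1Norm A := by
  simp [l1Norm, abs_mul, Finset.mul_sum]

lemma l1Norm_sub_le {ι κ : Type*} [Fintype ι] [Fintype κ] (A B : Matrix ι κ ℝ) :
    l1Norm (A - B) ≤ l1Norm A + l1Norm B := by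
  have := l1Norm_add_le A ((-1 : ℝ) • B)
  rwa [l1Norm_smul, abs_neg, abs_one, one_mul, neg_one_smul, ← sub_eq_add_neg] at this

lemma l1Norm_nonneg {ι κ : Type*} [Fintype ι] [Fintype κ] (A : Matrix ι κ ℝ) : 0 ≤ l1Norm A :=
  Finset.sum_nonneg fun _ _ => Finset.sum_nonneg fun _ _ => abs_nonneg _

lemma l1Norm_midpoint_le {ι κ : Type*} [Fintype ι] [Fintype κ] (A B : Matrix ι κ ℝ) :
    l1Norm ((1 / 2 : ℝ) • (A + B)) ≤ (l1Norm A + l1Norm B) / 2 := by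
  rw [l1Norm_smul, abs_of_pos (by norm_num)]
  linarith [l1Norm_add_le A B]

/-- Comparing the minimizer with the midpoint between itself and `θ` uses the strong convexity of
the quadratic part and gains half of the prediction error over the comparison with `θ`. -/
lemma IsFusedLasso.objective_add_le {lam1 lam2 : ℝ} (h1 : 0 ≤ lam1) (h2 : 0 ≤ lam2)
    {x : ℤ → Fin p → ℝ} {θhat : Fin n → Matrix (Fin p) (Fin q × Fin p) ℝ}
    (hmin : IsFusedLasso n q lam1 lam2 x θhat) (θ : Fin n → Matrix (Fin p) (Fin q × Fin p) ℝ) :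
    objective n q lam1 lam2 x θhat + predictionError n q x θhat θ / 2
      ≤ objective n q lam1 lam2 x θ := by
  have h := hmin fun i => (1 / 2 : ℝ) • (θhat i + θ i)
  have hquad : sqNorm (bigY n q x - bigZ n q x *ᵥ bigTheta fun i => (1 / 2 : ℝ) • (θhat i + θ i))
      = (sqNorm (bigY n q x - bigZ n q x *ᵥ bigTheta θhat)
          + sqNorm (bigY n q x - bigZ n q x *ᵥ bigTheta θ)) / 2
        - sqNorm (bigZ n q x *ᵥ (bigTheta θhat - bigTheta θ)) / 4 := by
    rw [bigTheta_midpoint, Matrix.mulVec_smul, Matrix.mulVec_add, sqNorm_midpoint,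
      Matrix.mulVec_sub]
  have hl1 : ∑ i, l1Norm ((1 / 2 : ℝ) • (θhat i + θ i))
      ≤ (∑ i, l1Norm (θhat i) + ∑ i, l1Norm (θ i)) / 2 := by
    rw [← Finset.sum_add_distrib, Finset.sum_div]
    exact Finset.sum_le_sum fun i _ => l1Norm_midpoint_le _ _
  have hl2 : ∑ k, l1Norm (∑ j ∈ Finset.Iic k, (1 / 2 : ℝ) • (θhat j + θ j))
      ≤ (∑ k, l1Norm (∑ j ∈ Finset.Iic k, θhat j)
        + ∑ k, l1Norm (∑ j ∈ Finset.Iic k, θ j)) / 2 := by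
    rw [← Finset.sum_add_distrib, Finset.sum_div]
    refine Finset.sum_le_sum fun k _ => ?_
    rw [← Finset.smul_sum, Finset.sum_add_distrib]
    exact l1Norm_midpoint_le _ _
  have hl1' := mul_le_mul_of_nonneg_left hl1 h1
  have hl2' := mul_le_mul_of_nonneg_left hl2 h2
  unfold objective at h ⊢
  unfold predictionError
  rw [hquad] at h
  linarith

lemma vecMul_bigZ (x : ℤ → Fin p → ℝ) (E : Fin p × Fin n → ℝ) (k : Fin p) (i : Fin n)
    (c : Fin q × Fin p) :
    (E ᵥ* bigZ n q x) (k, (i, c))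
      = ∑ r : Fin n, (if i ≤ r then lagVec q x ((q : ℤ) + (r : ℤ)) c else 0) * E (k, r) := by
  simp only [Matrix.vecMul, dotProduct, bigZ, Fintype.sum_prod_type, Matrix.kroneckerMap_apply,
    designMatrix]
  rw [Finset.sum_eq_single k]
  · exact Finset.sum_congr rfl fun r _ => by simp [mul_comm]
  · intro k' _ hk
    simp [Matrix.one_apply_ne hk]
  · simp

/-- The prediction error is controlled on the event that the score is dominated by the penalty. -/
lemma predictionError_le_of_score {lam1 lam2 : ℝ} (h1 : 0 ≤ lam1) (h2 : 0 ≤ lam2)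
    {x : ℤ → Fin p → ℝ} {θhat : Fin n → Matrix (Fin p) (Fin q × Fin p) ℝ}
    (hmin : IsFusedLasso n q lam1 lam2 x θhat) (θ : Fin n → Matrix (Fin p) (Fin q × Fin p) ℝ)
    (hscore : ∀ k i c, |1 / (n : ℝ) * ∑ r : Fin n,
      (if i ≤ r then lagVec q x ((q : ℤ) + (r : ℤ)) c else 0)
        * (bigY n q x - bigZ n q x *ᵥ bigTheta θ) (k, r)| ≤ lam1 / 4) :
    predictionError n q x θhat θ ≤ lam1 * ∑ i, l1Norm (θ i)
      + lam2 * ∑ k, l1Norm (∑ j ∈ Finset.Iic k, θ j) := by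
  set E := bigY n q x - bigZ n q x *ᵥ bigTheta θ with hE
  set Δ := bigTheta θhat - bigTheta θ with hΔ
  have hbasic := hmin.objective_add_le h1 h2 θ
  have hexpand : sqNorm (bigY n q x - bigZ n q x *ᵥ bigTheta θhat)
      = sqNorm E - 2 * (E ⬝ᵥ (bigZ n q x *ᵥ Δ)) + sqNorm (bigZ n q x *ᵥ Δ) := by
    have : bigY n q x - bigZ n q x *ᵥ bigTheta θhat = E - bigZ n q x *ᵥ Δ := by
      rw [hE, hΔ, Matrix.mulVec_sub]
      abel
    rw [this]
    simp only [sqNorm_eq_dotProduct, sub_dotProduct, dotProduct_sub,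
      dotProduct_comm (bigZ n q x *ᵥ Δ) E]
    ring
  have hcross : 1 / (n : ℝ) * (E ⬝ᵥ (bigZ n q x *ᵥ Δ))
      ≤ lam1 / 4 * (∑ i, l1Norm (θhat i) + ∑ i, l1Norm (θ i)) := by
    rw [Matrix.dotProduct_mulVec, dotProduct, Finset.mul_sum]
    calc ∑ z, 1 / (n : ℝ) * ((E ᵥ* bigZ n q x) z * Δ z)
        ≤ ∑ z, lam1 / 4 * |Δ z| := by
          refine Finset.sum_le_sum fun z _ => ?_
          obtain ⟨k, i, c⟩ := z
          rw [vecMul_bigZ, ← mul_assoc]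
          refine (le_abs_self _).trans ?_
          rw [abs_mul]
          exact mul_le_mul_of_nonneg_right (hscore k i c) (abs_nonneg _)
      _ = lam1 / 4 * ∑ i, l1Norm (θhat i - θ i) := by
          rw [← Finset.mul_sum]
          congr 1
          simp only [l1Norm, Fintype.sum_prod_type]
          rw [Finset.sum_comm]
          rfl
      _ ≤ lam1 / 4 * (∑ i, l1Norm (θhat i) + ∑ i, l1Norm (θ i)) := by
          rw [← Finset.sum_add_distrib]
          exact mul_le_mul_of_nonneg_left
            (Finset.sum_le_sum fun i _ => l1Norm_sub_le _ _) (by positivity)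
  have hpen0 : 0 ≤ lam2 * ∑ k, l1Norm (∑ j ∈ Finset.Iic k, θhat j) :=
    mul_nonneg h2 (Finset.sum_nonneg fun _ _ => l1Norm_nonneg _)
  have hpen : 0 ≤ lam2 * ∑ k, l1Norm (∑ j ∈ Finset.Iic k, θ j) :=
    mul_nonneg h2 (Finset.sum_nonneg fun _ _ => l1Norm_nonneg _)
  have hhat : 0 ≤ lam1 * ∑ i, l1Norm (θhat i) :=
    mul_nonneg h1 (Finset.sum_nonneg fun _ _ => l1Norm_nonneg _)
  unfold objective at hbasic
  unfold predictionError at hbasic ⊢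
  rw [hexpand, ← hE, ← hΔ] at hbasic
  rw [← hΔ]
  linarith

end Deterministic

/-! ### The true parameter -/

namespace Model

variable {p q T : ℕ} (M : Model p q T)

lemma seg_eq {t j : ℕ} (hj : j ∈ M.segments) (h1 : M.br (j - 1) ≤ t) (h2 : t < M.br j) :
    M.seg t = j := by
  have hj' := Finset.mem_Icc.1 hj
  have htT : t ≤ T := by
    have := M.br_mono hj'.2 le_rfl
    rw [M.br_last] at this
    omega
  obtain ⟨hs, h3, h4⟩ := M.seg_spec htT
  have hs' := Finset.mem_Icc.1 hs
  rcases lt_trichotomy (M.seg t) j with h | h | h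
  · have := M.br_mono (i := M.seg t) (j := j - 1) (by omega) (by omega)
    omega
  · exact h
  · have := M.br_mono (i := j) (j := M.seg t - 1) (by omega) (by omega)
    omega

/-- The segment index changes at break points only, and then by one. -/
lemma seg_succ {t : ℕ} (ht : t + 1 ≤ T) : M.seg (t + 1) = M.seg t ∨
    (M.seg t ∈ Finset.Icc 1 M.m0 ∧ t + 1 = M.br (M.seg t) ∧ M.seg (t + 1) = M.seg t + 1) := by
  obtain ⟨hs, h3, h4⟩ := M.seg_spec (t := t) (by omega)
  have hs' := Finset.mem_Icc.1 hs
  rcases lt_or_ge (t + 1) (M.br (M.seg t)) with h | h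
  · exact Or.inl (M.seg_eq hs (by omega) h)
  · right
    have hle : M.seg t ≤ M.m0 := by
      by_contra hcon
      have : M.seg t = M.m0 + 1 := by omega
      rw [this, M.br_last] at h
      omega
    refine ⟨Finset.mem_Icc.2 ⟨hs'.1, hle⟩, by omega, M.seg_eq ?_ ?_ ?_⟩
    · exact Finset.mem_Icc.2 ⟨by omega, by omega⟩
    · simpa using h
    · have := M.br_lt _ hle
      omega

lemma sum_theta {n : ℕ} (k : Fin n) :
    ∑ i ∈ Finset.Iic k, M.theta i = M.Φ (M.seg (q + k)) := by
  obtain ⟨k, hk⟩ := k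
  induction k with
  | zero =>
    have : Finset.Iic (⟨0, hk⟩ : Fin n) = {⟨0, hk⟩} := by
      ext i
      simp [Fin.le_def, Fin.ext_iff]
    rw [this, Finset.sum_singleton]
    simp [theta]
  | succ k ih =>
    have hsplit : Finset.Iic (⟨k + 1, hk⟩ : Fin n)
        = insert ⟨k + 1, hk⟩ (Finset.Iic (⟨k, by omega⟩ : Fin n)) := by
      ext i
      simp only [Finset.mem_Iic, Fin.le_def, Finset.mem_insert, Fin.ext_iff]
      omega
    rw [hsplit, Finset.sum_insert (by simp [Fin.le_def]), ih (by omega)]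
    simp [theta, ← add_assoc]

lemma l1Norm_Φ_le {B : ℝ} (hΦ : ∀ j ∈ M.segments, ∀ k c, |M.Φ j k c| ≤ B) {j : ℕ}
    (hj : j ∈ M.segments) : l1Norm (M.Φ j) ≤ B * ((∑ k, M.d k j : ℕ) : ℝ) := by
  have hj0 : j ≠ 0 := by
    have := (Finset.mem_Icc.1 hj).1
    omega
  rw [l1Norm, Nat.cast_sum, Finset.mul_sum]
  refine Finset.sum_le_sum fun k _ => ?_
  rw [d, if_neg hj0, ← Finset.sum_filter_add_sum_filter_not Finset.univ
    (fun c => M.Φ j k c ≠ 0) (fun c => |M.Φ j k c|)]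
  have h0 : ∑ c ∈ Finset.univ.filter (fun c => ¬ M.Φ j k c ≠ 0), |M.Φ j k c| = 0 := by
    refine Finset.sum_eq_zero fun c hc => ?_
    have := (Finset.mem_filter.1 hc).2
    rw [not_not] at this
    simp [this]
  rw [h0, add_zero]
  refine (Finset.sum_le_card_nsmul _ _ B fun c _ => hΦ j hj k c).trans_eq ?_
  rw [nsmul_eq_mul, mul_comm]

lemma le_maxSparsity {j : ℕ} (hj : j ∈ M.segments) :
    ∑ k, (M.d k j + M.d k (j - 1)) ≤ M.maxSparsity :=
  Finset.le_sup (f := fun j => ∑ k, (M.d k j + M.d k (j - 1))) hj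

/-- The `ℓ₁` norm of the true parameter, which has at most `m0 + 1` nonzero blocks. -/
lemma sum_l1Norm_theta_le {n : ℕ} (M : Model p q (n + q - 1)) {B : ℝ} (hB : 0 ≤ B)
    (hΦ : ∀ j ∈ M.segments, ∀ k c, |M.Φ j k c| ≤ B) :
    ∑ i : Fin n, l1Norm (M.theta i) ≤ ((M.m0 : ℝ) + 1) * (B * M.maxSparsity) := by
  classical
  let J : Finset ℕ := insert q ((Finset.Icc 1 M.m0).image M.br)
  have hbound : ∀ i : Fin n, l1Norm (M.theta i)
      ≤ if q + (i : ℕ) ∈ J then B * (M.maxSparsity : ℝ) else 0 := by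
    intro i
    have hi := i.2
    by_cases hi0 : (i : ℕ) = 0
    · have hseg := (M.seg_spec (t := q) (by omega)).1
      rw [theta, if_pos hi0, if_pos (by simp [J, hi0])]
      refine (M.l1Norm_Φ_le hΦ hseg).trans ?_
      refine mul_le_mul_of_nonneg_left ?_ hB
      have := M.le_maxSparsity hseg
      rw [Finset.sum_add_distrib] at this
      exact_mod_cast le_trans (Nat.le_add_right _ _) this
    · obtain ⟨t, ht⟩ : ∃ t, q + (i : ℕ) = t + 1 := ⟨q + i - 1, by omega⟩
      rw [theta, if_neg hi0, ht, Nat.add_sub_cancel]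
      rcases M.seg_succ (t := t) (by omega) with h | ⟨hj, hbr, hs⟩
      · rw [h, sub_self]
        have : l1Norm (0 : Matrix (Fin p) (Fin q × Fin p) ℝ) = 0 := by simp [l1Norm]
        rw [this]
        split_ifs
        · positivity
        · exact le_rfl
      · rw [if_pos (Finset.mem_insert_of_mem (Finset.mem_image.2 ⟨_, hj, hbr.symm⟩)), hs]
        have hj' := Finset.mem_Icc.1 hj
        have hm1 : M.seg t ∈ M.segments := Finset.mem_Icc.2 ⟨by omega, by omega⟩
        have hm2 : M.seg t + 1 ∈ M.segments := Finset.mem_Icc.2 ⟨by omega, by omega⟩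
        refine (l1Norm_sub_le _ _).trans
          ((add_le_add (M.l1Norm_Φ_le hΦ hm2) (M.l1Norm_Φ_le hΦ hm1)).trans ?_)
        rw [← mul_add]
        refine mul_le_mul_of_nonneg_left ?_ hB
        have := M.le_maxSparsity hm2
        rw [Finset.sum_add_distrib, Nat.add_sub_cancel] at this
        exact_mod_cast this
  refine (Finset.sum_le_sum fun i _ => hbound i).trans ?_
  rw [← Finset.sum_filter, Finset.sum_const, nsmul_eq_mul]
  refine mul_le_mul_of_nonneg_right ?_ (by positivity)
  have h1 : (Finset.univ.filter fun i : Fin n => q + (i : ℕ) ∈ J).card ≤ J.card :=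
    Finset.card_le_card_of_injOn (fun i => q + (i : ℕ))
      (fun i hi => (Finset.mem_filter.1 hi).2) fun i _ k _ hik => Fin.ext (by simpa using hik)
  have h2 : J.card ≤ M.m0 + 1 := by
    refine (Finset.card_insert_le _ _).trans ?_
    have := Finset.card_image_le (s := Finset.Icc 1 M.m0) (f := M.br)
    rw [Nat.card_Icc] at this
    omega
  exact_mod_cast h1.trans h2

lemma sum_l1Norm_partialSum_le {n : ℕ} (M : Model p q (n + q - 1)) {B : ℝ} (hB : 0 ≤ B)
    (hΦ : ∀ j ∈ M.segments, ∀ k c, |M.Φ j k c| ≤ B) :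
    ∑ k : Fin n, l1Norm (∑ j ∈ Finset.Iic k, M.theta j) ≤ n * (B * M.dstar) := by
  have : ∀ k ∈ (Finset.univ : Finset (Fin n)),
      l1Norm (∑ j ∈ Finset.Iic k, M.theta j) ≤ B * M.dstar := by
    intro k _
    have hk := k.2
    have hseg := (M.seg_spec (t := q + k) (by omega)).1
    rw [M.sum_theta]
    refine (M.l1Norm_Φ_le hΦ hseg).trans (mul_le_mul_of_nonneg_left ?_ hB)
    have := Finset.single_le_sum (f := fun j => ∑ k, M.d k j) (fun _ _ => Nat.zero_le _) hseg
    exact_mod_cast this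
  refine (Finset.sum_le_card_nsmul _ _ _ this).trans_eq ?_
  simp

/-- The residuals at the true parameter. -/
lemma residual_eq {n : ℕ} (M : Model p q (n + q - 1)) (x : ℤ → Fin p → ℝ) (k : Fin p)
    (r : Fin n) :
    (bigY n q x - bigZ n q x *ᵥ bigTheta (M.theta (n := n))) (k, r)
      = x ((q : ℤ) + r) k - (M.Φ (M.seg (q + r)) *ᵥ lagVec q x ((q : ℤ) + r)) k := by
  have h1 : (bigZ n q x *ᵥ bigTheta (M.theta (n := n))) (k, r)
      = ((∑ i ∈ Finset.Iic r, M.theta i) *ᵥ lagVec q x ((q : ℤ) + r)) k := by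
    have hZ : ∀ (k' : Fin p) (z : Fin n × (Fin q × Fin p)), bigZ n q x (k, r) (k', z)
        = if k = k' then designMatrix n q x r z else 0 := by
      intro k' z
      simp [bigZ, Matrix.kroneckerMap_apply, Matrix.one_apply]
    simp only [Matrix.mulVec, dotProduct]
    rw [Fintype.sum_prod_type]
    simp only [hZ, ite_mul, zero_mul, Finset.sum_ite_irrel, Finset.sum_const_zero]
    rw [Finset.sum_ite_eq Finset.univ k, if_pos (Finset.mem_univ k), Fintype.sum_prod_type]
    simp only [designMatrix, Matrix.sum_apply, Finset.sum_mul]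
    rw [Finset.sum_comm]
    refine Finset.sum_congr rfl fun c _ => ?_
    rw [← Finset.sum_filter_add_sum_filter_not Finset.univ (fun i : Fin n => i ≤ r)]
    have hf : Finset.univ.filter (fun i : Fin n => i ≤ r) = Finset.Iic r := by
      ext i
      simp
    rw [Finset.sum_eq_zero (s := Finset.univ.filter fun i : Fin n => ¬ i ≤ r), add_zero, hf]
    · refine Finset.sum_congr rfl fun i hi => ?_
      rw [if_pos (Finset.mem_Iic.1 hi), mul_comm]
      rfl
    · intro i hi
      rw [if_neg (Finset.mem_filter.1 hi).2, zero_mul]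
  rw [Pi.sub_apply, h1, M.sum_theta]
  rfl

end Model

/-! ### The probability that the score exceeds the penalty level -/

section Score

variable {Ω : Type*} [mΩ : MeasurableSpace Ω] {P : Measure Ω}

lemma LinPast.integral_eq_zero {p : ℕ} {Y : ℤ → Ω → Fin p → ℝ} (hG : IsGaussianProcess Y P)
    (h0 : ∀ s c, ∫ ω, Y s ω c ∂P = 0) {t : ℤ} {f : Ω → ℝ} (hf : LinPast P Y t f) :
    ∫ ω, f ω ∂P = 0 := by
  obtain ⟨g, hg, hfg⟩ := hf
  rw [integral_congr_ae hfg]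
  have hmem : ∀ g ∈ pastSpan Y t, LinPast P Y t g := fun g hg => ⟨g, hg, ae_eq_rfl⟩
  have hint : ∀ g ∈ pastSpan Y t, Integrable g P := fun g hg =>
    ((hmem g hg).hasGaussianLaw hG).integrable
  clear hfg
  induction hg using Submodule.span_induction with
  | mem g hg =>
    obtain ⟨s, -, c, rfl⟩ := hg
    exact h0 s c
  | zero => simp
  | add u v hu hv ihu ihv =>
    simp only [Pi.add_apply]
    rw [integral_add (hint u hu) (hint v hv), ihu, ihv, add_zero]
  | smul c u hu ih =>
    simp only [Pi.smul_apply, smul_eq_mul]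
    rw [integral_const_mul, ih, mul_zero]

lemma lintegral_exp_of_hasGaussianLaw {f : Ω → ℝ} (hf : HasGaussianLaw f P)
    (h0 : ∫ ω, f ω ∂P = 0) :
    ∫⁻ ω, ENNReal.ofReal (Real.exp (f ω)) ∂P = ENNReal.ofReal (Real.exp (Var[f; P] / 2)) := by
  have h := lintegral_exp_mul_gaussianReal Var[f; P].toNNReal 1
  have hlaw := hf.map_eq_gaussianReal
  rw [h0] at hlaw
  rw [← hlaw, lintegral_map' (by fun_prop) hf.aemeasurable] at h
  simpa [Real.coe_toNNReal _ (variance_nonneg f P)] using h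

variable [IsProbabilityMeasure P] {p q : ℕ} [NeZero q]

lemma IsStationaryGaussianVAR.form_Sig_le {Φ : Matrix (Fin p) (Fin q × Fin p) ℝ}
    {Sig : Matrix (Fin p) (Fin p) ℝ} {ε Y : ℤ → Ω → Fin p → ℝ}
    (hY : IsStationaryGaussianVAR P Φ Sig ε Y) (hε : IsGaussianWhiteNoise P ε)
    (hSig : Sig.PosSemidef) {a b : ℝ} (hs : SpectrumBetween (autocov P Y) a b) (k : Fin p) :
    (Pi.single k 1 : Fin p → ℝ) ⬝ᵥ (Sig *ᵥ Pi.single k 1) ≤ 2 * Real.pi * b := by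
  let w : Fin q × Fin p → ℝ := Pi.single (0, k) 1
  have hw : headVec w = Pi.single k 1 := by
    ext i
    simp [w, headVec, Pi.single_apply]
  have h1 := hY.lagForm_eq hε hSig w
  have h2 := (hY.lagForm_bounds hs w).2
  have h3 : sqNorm w = 1 := by
    rw [sqNorm_eq_dotProduct]
    simp [w]
  have h4 : 0 ≤ lagForm P Y (dualStep Φ w) := variance_nonneg _ _
  rw [h3] at h2
  rw [hw] at h1
  linarith

variable {n : ℕ} {M : Model p q (n + q - 1)} {ε : ℤ → Ω → Fin p → ℝ}
  {Y : ℕ → ℤ → Ω → Fin p → ℝ} {y : ℤ → Ω → Fin p → ℝ} {a b K : ℝ}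

/-- The observed components have bounded empirical second moments. -/
lemma measure_sum_sq_path_ge_le (hy : M.IsPath P ε Y y) (hε : IsGaussianWhiteNoise P ε)
    (ha : 0 < a) (hab : a ≤ b) (hA : StationaritySpectrum M P ε Y a b) (hK : 0 < K)
    (hvar : ∀ (c : Fin p) (g : ℕ → ℝ),
      Var[fun ω => ∑ s ∈ Finset.range (n + q - 1 + 1), g s * y s ω c; P]
        ≤ K * ∑ s ∈ Finset.range (n + q - 1 + 1), g s ^ 2) (c : Fin p) :
    P {ω | 8 * K * ((n + q - 1 + 1 : ℕ) : ℝ)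
        ≤ ∑ s ∈ Finset.range (n + q - 1 + 1), y s ω c ^ 2}
      ≤ ENNReal.ofReal (Real.exp (-n)) := by
  obtain ⟨hY, hs⟩ := hA 1 M.one_mem_segments
  have hmean : ∀ s c, ∫ ω, Y 1 s ω c ∂P = 0 := by
    intro s c
    have := hY.integral_lagVec_eq_zero hε (M.Sig_psd 1) ha (ha.trans_le hab) hab hs (s + 1)
      (Pi.single (0, c) 1)
    simpa [lagVec] using this
  have hlin : ∀ g : ℕ → ℝ, LinPast P (Y 1) ((n + q - 1 : ℕ) + 1)
      (fun ω => ∑ s ∈ Finset.range (n + q - 1 + 1), g s * y s ω c) := by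
    intro g
    refine LinPast.sum _ fun s hs => LinPast.const_mul ?_ _
    have := Finset.mem_range.1 hs
    exact (hy.linPast hε ha hA (t := s) (by omega) c).mono (by omega)
  have h := measure_sum_sq_ge_le (P := P) (N := n + q - 1 + 1)
    (X := fun i ω => y (i : ℕ) ω c) (fun i => by
      have hi := i.2
      exact ((hy.linPast hε ha hA (t := ((i : ℕ) : ℤ)) (by omega) c).hasGaussianLaw
        hY.gaussian).aemeasurable) hK (fun g => by
      have hg : ∀ ω, ∑ i, g i * y (i : ℕ) ω c = ∑ s ∈ Finset.range (n + q - 1 + 1),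
          (if h : s < n + q - 1 + 1 then g ⟨s, h⟩ else 0) * y s ω c := by
        intro ω
        rw [Finset.sum_range]
        exact Finset.sum_congr rfl fun i _ => by rw [dif_pos i.2]
      have hg2 : ∑ i, g i ^ 2 = ∑ s ∈ Finset.range (n + q - 1 + 1),
          (if h : s < n + q - 1 + 1 then g ⟨s, h⟩ else 0) ^ 2 := by
        rw [Finset.sum_range]
        exact Finset.sum_congr rfl fun i _ => by rw [dif_pos i.2]
      simp_rw [hg]
      rw [lintegral_exp_of_hasGaussianLaw ((hlin _).hasGaussianLaw hY.gaussian)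
        ((hlin _).integral_eq_zero hY.gaussian hmean), hg2]
      refine ENNReal.ofReal_le_ofReal (Real.exp_le_exp.2 ?_)
      have := hvar c fun s => if h : s < n + q - 1 + 1 then g ⟨s, h⟩ else 0
      linarith)
  simp_rw [Finset.sum_range]
  refine h.trans (ENNReal.ofReal_le_ofReal (Real.exp_le_exp.2 ?_))
  have hq : 0 < q := Nat.pos_of_ne_zero (NeZero.ne q)
  have : (n : ℝ) ≤ ((n + q - 1 + 1 : ℕ) : ℝ) := by
    exact_mod_cast (by omega : n ≤ n + q - 1 + 1)
  linarith

/-- With high probability, the score at the true parameter is dominated by the penalty. -/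
lemma measure_score_gt_le (hy : M.IsPath P ε Y y) (hε : IsGaussianWhiteNoise P ε)
    (ha : 0 < a) (hab : a ≤ b) (hA : StationaritySpectrum M P ε Y a b) (hK : 0 < K)
    (hvar : ∀ (c : Fin p) (g : ℕ → ℝ),
      Var[fun ω => ∑ s ∈ Finset.range (n + q - 1 + 1), g s * y s ω c; P]
        ≤ K * ∑ s ∈ Finset.range (n + q - 1 + 1), g s ^ 2)
    (hn : 1 ≤ n) (hp : 1 ≤ p) {C : ℝ} (hC0 : 0 ≤ C)
    (hC : 256 * Real.pi * b * K * (1 + q) ≤ C ^ 2) :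
    P {ω | ¬ ∀ k i c, |1 / (n : ℝ) * ∑ r : Fin n,
      (if i ≤ r then lagVec q (fun t => y t ω) ((q : ℤ) + (r : ℤ)) c else 0)
        * (bigY n q (fun t => y t ω)
          - bigZ n q (fun t => y t ω) *ᵥ bigTheta M.theta) (k, r)| ≤ lambda1 C n p q / 4}
      ≤ p * ENNReal.ofReal (Real.exp (-n)) + ENNReal.ofReal (2 / n) := by
  obtain ⟨hY, hs⟩ := hA 1 M.one_mem_segments
  have hq : 1 ≤ q := Nat.pos_of_ne_zero (NeZero.ne q)
  have hb : 0 < b := ha.trans_le hab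
  have hπ := Real.pi_pos
  have hn' : (1 : ℝ) ≤ n := by exact_mod_cast hn
  have hp' : (1 : ℝ) ≤ p := by exact_mod_cast hp
  have hq' : (1 : ℝ) ≤ q := by exact_mod_cast hq
  set N : ℕ := n + q - 1 + 1 with hN
  have hNR : (N : ℝ) = n + q := by
    have : N = n + q := by omega
    rw [this]
    push_cast
    ring
  set ℓ : ℝ := Real.log n + 2 * Real.log p + Real.log q with hℓ
  have hℓ0 : 0 ≤ ℓ := by
    have := Real.log_nonneg hn'
    have := Real.log_nonneg hp'
    have := Real.log_nonneg hq'
    positivity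
  set V : ℝ := 2 * Real.pi * b * (8 * K * N) with hV
  have hV0 : 0 < V := by
    rw [hV, hNR]
    positivity
  set s : ℝ := n * (C / 2 * √(ℓ / n)) with hs'
  have hs0 : 0 ≤ s := by positivity
  -- the exponent in the deviation inequality beats the number `n p² q` of coordinates twice
  have hexpo : 2 * ℓ ≤ s ^ 2 / (2 * V) := by
    have hs2 : s ^ 2 = n * C ^ 2 * ℓ / 4 := by
      rw [hs', mul_pow, mul_pow, Real.sq_sqrt (by positivity)]
      field_simp
      ring
    rw [hs2, le_div_iff₀ (by positivity), hV, hNR]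
    have h1 : (n : ℝ) + q ≤ n * (1 + q) := by nlinarith
    calc 2 * ℓ * (2 * (2 * Real.pi * b * (8 * K * (n + q))))
        ≤ 2 * ℓ * (2 * (2 * Real.pi * b * (8 * K * (n * (1 + q))))) := by gcongr
      _ = (256 * Real.pi * b * K * (1 + q)) * (n * ℓ / 4) := by ring
      _ ≤ C ^ 2 * (n * ℓ / 4) := by gcongr
      _ = n * C ^ 2 * ℓ / 4 := by ring
  let η : Fin p → ℕ → Ω → ℝ := fun k r ω =>
    (Pi.single k 1 : Fin p → ℝ) ⬝ᵥ (psdSqrt (M.Sig (M.seg (q + r))) *ᵥ ε ((q : ℤ) + r) ω)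
  let x : Fin n → Fin q × Fin p → ℕ → Ω → ℝ := fun i c r ω =>
    if (i : ℕ) ≤ r then lagVec q (fun t => y t ω) ((q : ℤ) + r) c else 0
  let B1 : Fin p → Set Ω := fun c => {ω | 8 * K * (N : ℝ)
    ≤ ∑ t ∈ Finset.range N, y t ω c ^ 2}
  let B2 : Fin p × Fin n × (Fin q × Fin p) → Set Ω := fun z =>
    {ω | s ≤ |∑ r ∈ Finset.range n, x z.2.1 z.2.2 r ω * η z.1 r ω| ∧
      ∑ r ∈ Finset.range n, ((Pi.single z.1 1 : Fin p → ℝ) ⬝ᵥ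
        (M.Sig (M.seg (q + r)) *ᵥ Pi.single z.1 1)) * x z.2.1 z.2.2 r ω ^ 2 ≤ V}
  let B3 : Set Ω := {ω | ¬ ∀ r : Fin n, y ((q : ℤ) + (r : ℕ)) ω
    = M.Φ (M.seg (q + r)) *ᵥ lagVec q (fun t => y t ω) ((q : ℤ) + (r : ℕ))
      + psdSqrt (M.Sig (M.seg (q + r))) *ᵥ ε ((q : ℤ) + (r : ℕ)) ω}
  have hB1 : ∀ c, P (B1 c) ≤ ENNReal.ofReal (Real.exp (-n)) :=
    measure_sum_sq_path_ge_le hy hε ha hab hA hK hvar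
  have hB2 : ∀ z, P (B2 z) ≤ 2 * ENNReal.ofReal (Real.exp (-(2 * ℓ))) := by
    rintro ⟨k, i, c⟩
    refine (measure_sum_mul_noise_ge_le (Y := Y 1) hY.measurable hε hY.causal
      (fun t k => hY.linPast_noise hε (M.Sig_psd 1) ha hs t k) (q : ℤ) (N := n) (x := x i c) ?_
      (A := fun r => M.Sig (M.seg (q + r))) (fun r => M.Sig_psd _) (Pi.single k 1) hV0
      hs0).trans ?_
    · intro r hr
      by_cases hir : (i : ℕ) ≤ r
      · simp only [x, hir, if_true]
        exact hy.linPast_lagVec hε ha hA (by omega) c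
      · simp only [x, hir, if_false]
        exact LinPast.zero _
    · gcongr
  have hB3 : P B3 = 0 := by
    have : ∀ᵐ ω ∂P, ∀ r : Fin n, y ((q : ℤ) + (r : ℕ)) ω
        = M.Φ (M.seg (q + r)) *ᵥ lagVec q (fun t => y t ω) ((q : ℤ) + (r : ℕ))
          + psdSqrt (M.Sig (M.seg (q + r))) *ᵥ ε ((q : ℤ) + (r : ℕ)) ω := by
      refine ae_all_iff.2 fun r => ?_
      have hr := r.2
      obtain ⟨h1, h2, h3⟩ := M.seg_spec (t := q + r) (by omega)
      exact hy.recursion _ h1 ((q : ℤ) + (r : ℕ)) (by exact_mod_cast h2) (by exact_mod_cast h3)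
    exact this
  have hsub : {ω | ¬ ∀ k i c, |1 / (n : ℝ) * ∑ r : Fin n,
      (if i ≤ r then lagVec q (fun t => y t ω) ((q : ℤ) + (r : ℤ)) c else 0)
        * (bigY n q (fun t => y t ω)
          - bigZ n q (fun t => y t ω) *ᵥ bigTheta M.theta) (k, r)| ≤ lambda1 C n p q / 4}
      ⊆ (⋃ c, B1 c) ∪ ((⋃ z, B2 z) ∪ B3) := by
    intro ω hω
    by_contra hcon
    simp only [Set.mem_union, Set.mem_iUnion, not_or, not_exists] at hcon
    obtain ⟨h1, h2, h3⟩ := hcon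
    refine hω fun k i c => ?_
    have h3' : ∀ r : Fin n, y ((q : ℤ) + (r : ℕ)) ω
        = M.Φ (M.seg (q + r)) *ᵥ lagVec q (fun t => y t ω) ((q : ℤ) + (r : ℕ))
          + psdSqrt (M.Sig (M.seg (q + r))) *ᵥ ε ((q : ℤ) + (r : ℕ)) ω := by
      by_contra h
      exact h3 h
    have hres : ∑ r : Fin n,
        (if i ≤ r then lagVec q (fun t => y t ω) ((q : ℤ) + (r : ℤ)) c else 0)
          * (bigY n q (fun t => y t ω)
            - bigZ n q (fun t => y t ω) *ᵥ bigTheta M.theta) (k, r)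
        = ∑ r ∈ Finset.range n, x i c r ω * η k r ω := by
      rw [Finset.sum_range]
      refine Finset.sum_congr rfl fun r _ => ?_
      rw [M.residual_eq]
      have h5 := congrFun (h3' r) k
      rw [Pi.add_apply] at h5
      rw [h5, add_sub_cancel_left]
      simp only [x, η, single_one_dotProduct]
      rfl
    have hQ : ∑ r ∈ Finset.range n, ((Pi.single k 1 : Fin p → ℝ) ⬝ᵥ
        (M.Sig (M.seg (q + r)) *ᵥ Pi.single k 1)) * x i c r ω ^ 2 ≤ V := by
      obtain ⟨l, c⟩ := c
      have hl := l.2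
      have hterm : ∀ r ∈ Finset.range n, ((Pi.single k 1 : Fin p → ℝ) ⬝ᵥ
          (M.Sig (M.seg (q + r)) *ᵥ Pi.single k 1)) * x i (l, c) r ω ^ 2
          ≤ 2 * Real.pi * b * y ((r + (q - 1 - l) : ℕ) : ℤ) ω c ^ 2 := by
        intro r hr
        have hr' := Finset.mem_range.1 hr
        have hseg := (M.seg_spec (t := q + r) (by omega)).1
        have h6 := (hA _ hseg).1.form_Sig_le hε (M.Sig_psd _) (hA _ hseg).2 k
        have h7 : x i (l, c) r ω ^ 2 ≤ y ((r + (q - 1 - l) : ℕ) : ℤ) ω c ^ 2 := by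
          simp only [x, lagVec]
          have h8 : (q : ℤ) + r - 1 - (l : ℤ) = ((r + (q - 1 - l) : ℕ) : ℤ) := by omega
          rw [h8]
          split_ifs
          · exact le_rfl
          · simpa using sq_nonneg (y ((r + (q - 1 - l) : ℕ) : ℤ) ω c)
        gcongr
      refine (Finset.sum_le_sum hterm).trans ?_
      rw [← Finset.mul_sum, hV]
      refine mul_le_mul_of_nonneg_left ?_ (by positivity)
      have h9 : ∑ r ∈ Finset.range n, y ((r + (q - 1 - l) : ℕ) : ℤ) ω c ^ 2
          ≤ ∑ t ∈ Finset.range N, y t ω c ^ 2 := by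
        refine (Finset.sum_map (Finset.range n) (addRightEmbedding (q - 1 - (l : ℕ)))
          (fun t : ℕ => y (t : ℤ) ω c ^ 2)).symm.trans_le ?_
        refine Finset.sum_le_sum_of_subset_of_nonneg ?_ fun _ _ _ => sq_nonneg _
        intro t ht
        obtain ⟨r, hr, rfl⟩ := Finset.mem_map.1 ht
        have := Finset.mem_range.1 hr
        simp only [addRightEmbedding_apply, Finset.mem_range]
        omega
      exact h9.trans (not_le.1 (h1 c)).le
    have hlt : |∑ r ∈ Finset.range n, x i c r ω * η k r ω| < s := by
      by_contra hge
      exact h2 (k, i, c) ⟨not_lt.1 hge, hQ⟩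
    rw [hres, abs_mul, abs_of_pos (by positivity), one_div, inv_mul_le_iff₀ (by positivity)]
    refine hlt.le.trans_eq ?_
    rw [hs', lambda1, hℓ]
    ring
  have hcount : ∑ z : Fin p × Fin n × (Fin q × Fin p), P (B2 z) ≤ ENNReal.ofReal (2 / n) := by
    refine (Finset.sum_le_card_nsmul _ _ _ fun z _ => hB2 z).trans ?_
    have hcard : (Finset.univ : Finset (Fin p × Fin n × (Fin q × Fin p))).card
        = p * (n * (q * p)) := by simp
    rw [hcard, nsmul_eq_mul, ← ENNReal.ofReal_natCast, ← ENNReal.ofReal_ofNat 2,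
      ← ENNReal.ofReal_mul (by norm_num), ← ENNReal.ofReal_mul (by positivity)]
    refine ENNReal.ofReal_le_ofReal ?_
    have hexp : Real.exp (-(2 * ℓ)) = 1 / ((n : ℝ) * p ^ 2 * q) ^ 2 := by
      have : ℓ = Real.log ((n : ℝ) * p ^ 2 * q) := by
        rw [Real.log_mul (by positivity) (by positivity), Real.log_mul (by positivity)
          (by positivity), Real.log_pow, hℓ]
        push_cast
        ring
      rw [Real.exp_neg, this, mul_comm, Real.exp_mul, Real.exp_log (by positivity), one_div]
      norm_cast
    rw [hexp]
    push_cast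
    have h1 : (1 : ℝ) ≤ p ^ 2 * q := by nlinarith [one_le_pow₀ hp' (n := 2)]
    have h2 : (p : ℝ) * (n * (q * p)) * (2 * (1 / ((n : ℝ) * p ^ 2 * q) ^ 2))
        = 2 / (n * (p ^ 2 * q)) := by
      field_simp
    rw [h2]
    gcongr
    nlinarith
  calc P _ ≤ P ((⋃ c, B1 c) ∪ ((⋃ z, B2 z) ∪ B3)) := measure_mono hsub
    _ ≤ P (⋃ c, B1 c) + (P (⋃ z, B2 z) + P B3) :=
      (measure_union_le _ _).trans (add_le_add le_rfl (measure_union_le _ _))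
    _ ≤ ∑ c, P (B1 c) + (∑ z, P (B2 z) + 0) := by
      rw [hB3]
      gcongr
      · exact measure_iUnion_fintype_le _ _
      · exact measure_iUnion_fintype_le _ _
    _ ≤ p * ENNReal.ofReal (Real.exp (-n)) + ENNReal.ofReal (2 / n) := by
      rw [add_zero]
      refine add_le_add ?_ hcount
      refine (Finset.sum_le_card_nsmul _ _ _ fun c _ => hB1 c).trans_eq ?_
      simp

end Score

/-! ### Asymptotics -/

lemma lambda1_nonneg {C : ℝ} (hC : 0 ≤ C) (n p q : ℕ) : 0 ≤ lambda1 C n p q :=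
  mul_nonneg (by positivity) (Real.sqrt_nonneg _)

/-- If `λ₁ ≤ 2C`, the dimension grows at most exponentially: `2 log p ≤ n`. -/
lemma two_log_le_of_lambda1_le {C : ℝ} (hC : 0 < C) {n p q : ℕ} (hn : 1 ≤ n)
    (hq : 1 ≤ q) (h : lambda1 C n p q ≤ 2 * C) : 2 * Real.log p ≤ n := by
  have hn' : (1 : ℝ) ≤ n := by exact_mod_cast hn
  have hq' : (1 : ℝ) ≤ q := by exact_mod_cast hq
  rw [lambda1] at h
  have h1 := (mul_le_iff_le_one_right (show 0 < 2 * C by positivity)).1 h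
  have h2 := (Real.sqrt_le_left zero_le_one).1 h1
  rw [one_pow, div_le_one (by positivity)] at h2
  have := Real.log_nonneg hn'
  have := Real.log_nonneg hq'
  linarith

end FusedVAR

theorem theorem1
    -- order `q`; dimension `p n`; the sample is `y_0, …, y_T` with `T = n + q - 1`
    (q : ℕ) (hq : 1 ≤ q) (p : ℕ → ℕ) (hp : ∀ n, 1 ≤ p n)
    (M : ∀ n, Model (p n) q (n + q - 1))
    {Ω : ℕ → Type*} [∀ n, MeasurableSpace (Ω n)]
    (P : ∀ n, Measure (Ω n)) [∀ n, IsProbabilityMeasure (P n)]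
    -- noise, stationary processes of the segments, and the observed process
    (ε : ∀ n, ℤ → Ω n → Fin (p n) → ℝ) (hε : ∀ n, IsGaussianWhiteNoise (P n) (ε n))
    (Y : ∀ n, ℕ → ℤ → Ω n → Fin (p n) → ℝ)
    (y : ∀ n, ℤ → Ω n → Fin (p n) → ℝ) (hy : ∀ n, (M n).IsPath (P n) (ε n) (Y n) (y n))
    -- stationarity, with spectral bounds that are uniform over the segments and over `n`
    (a b : ℝ) (ha : 0 < a)
    (hA1 : ∀ n, StationaritySpectrum (M n) (P n) (ε n) (Y n) a b)
    -- sparsity and bounded coefficients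
    (hA2 : ∀ δ : ℝ, 0 < δ → ∀ᶠ n in atTop, ∀ j ∈ Finset.Icc 1 (M n).m0, ∀ k,
      ((M n).d k j : ℝ) / (p n : ℝ) ≤ δ)
    (MΦ : ℝ) (hMΦ : 0 < MΦ)
    (hΦ : ∀ n, ∀ j ∈ (M n).segments, ∀ k c, |(M n).Φ j k c| ≤ MΦ)
    -- the distance between consecutive break points tends to infinity
    (hgap : ∀ L : ℕ, ∀ᶠ n in atTop, ∀ j, 1 ≤ j → j < (M n).m0 →
      (M n).br j + L ≤ (M n).br (j + 1)) :
    ∃ C₀ : ℝ, 0 < C₀ ∧ ∀ C : ℝ, C₀ ≤ C →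
      ∀ lam2 : ℕ → ℝ, (∀ n, 0 ≤ lam2 n) →
        Tendsto (fun n : ℕ => lam2 n * ((n : ℝ) * ((M n).dstar : ℝ))) atTop (𝓝 0) →
      ∀ m : ℕ → ℝ, (∀ n, 1 ≤ m n) → (∀ n, ((M n).m0 : ℝ) ≤ m n) →
        (m =o[atTop] fun n => (lambda1 C n (p n) q)⁻¹) →
      ∀ θhat : ∀ n, Ω n → Fin n → Matrix (Fin (p n)) (Fin q × Fin (p n)) ℝ,
        (∀ n ω, IsFusedLasso n q (lambda1 C n (p n) q) (lam2 n) (fun t => y n t ω) (θhat n ω)) →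
      ∃ r : ℕ → ℝ, Tendsto r atTop (𝓝 0) ∧
        -- the probability of the complementary event tends to zero
        Tendsto (fun n => P n {ω |
            2 * MΦ * lambda1 C n (p n) q * m n * ((M n).maxSparsity : ℝ) + r n
              < predictionError n q (fun t => y n t ω) (θhat n ω) (M n).theta})
          atTop (𝓝 0) := by
  have : NeZero q := ⟨by omega⟩
  have hab : a ≤ b := (hA1 0 1 (M 0).one_mem_segments).2.le (hp 0)
  have hb : 0 < b := ha.trans_le hab
  have hπ := Real.pi_pos
  obtain ⟨K, hK, L, hvar⟩ := exists_variance_bound q ha hab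
  refine ⟨√(256 * Real.pi * b * K * (1 + q)) + 1, by positivity, ?_⟩
  intro C hC lam2 hlam2 hlim m hm1 hm0 hmo θhat hθ
  have hC1 : 0 < C := lt_of_lt_of_le (by positivity) hC
  have hC2 : 256 * Real.pi * b * K * (1 + q) ≤ C ^ 2 :=
    (Real.sqrt_le_left hC1.le).1 (by linarith)
  refine ⟨fun n => MΦ * (lam2 n * ((n : ℝ) * ((M n).dstar : ℝ))), by
    simpa using hlim.const_mul MΦ, ?_⟩
  have hbound : ∀ᶠ n : ℕ in atTop, P n {ω |
      2 * MΦ * lambda1 C n (p n) q * m n * ((M n).maxSparsity : ℝ)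
        + MΦ * (lam2 n * ((n : ℝ) * ((M n).dstar : ℝ)))
        < predictionError n q (fun t => y n t ω) (θhat n ω) (M n).theta}
      ≤ ENNReal.ofReal (Real.exp (-(n / 2))) + ENNReal.ofReal (2 / n) := by
    filter_upwards [hgap L, eventually_ge_atTop 1, hmo.def (show 0 < 2 * C by positivity)]
      with n hgapn hn hmn
    set lam := lambda1 C n (p n) q with hlam
    have hlam0 : 0 ≤ lam := lambda1_nonneg hC1.le _ _ _
    have hlamC : lam ≤ 2 * C := by
      rw [Real.norm_eq_abs, Real.norm_eq_abs, abs_of_nonneg (by linarith [hm1 n]),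
        abs_of_nonneg (inv_nonneg.2 hlam0)] at hmn
      rcases hlam0.eq_or_lt with h | h
      · rw [← h]
        positivity
      · have := (hm1 n).trans hmn
        rwa [← div_eq_mul_inv, one_le_div h] at this
    have hlogp := two_log_le_of_lambda1_le hC1 hn hq hlamC
    have hpn : (0 : ℝ) < p n := by exact_mod_cast hp n
    have hscore := measure_score_gt_le (hy n) (hε n) ha hab (hA1 n) hK
      (hvar (hy n) (hε n) (hA1 n) hgapn) hn (hp n) hC1.le hC2
    refine (measure_mono ?_).trans (hscore.trans (add_le_add ?_ le_rfl))
    · intro ω hω hgood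
      refine absurd (predictionError_le_of_score hlam0 (hlam2 n) (hθ n ω) (M n).theta hgood)
        (not_le.2 (lt_of_le_of_lt ?_ hω))
      have h1 := mul_le_mul_of_nonneg_left ((M n).sum_l1Norm_theta_le hMΦ.le (hΦ n)) hlam0
      have h2 := mul_le_mul_of_nonneg_left ((M n).sum_l1Norm_partialSum_le hMΦ.le (hΦ n))
        (hlam2 n)
      have h3 : ((M n).m0 : ℝ) + 1 ≤ 2 * m n := by linarith [hm1 n, hm0 n]
      have h4 : lam * ((((M n).m0 : ℝ) + 1) * (MΦ * (M n).maxSparsity))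
          ≤ lam * ((2 * m n) * (MΦ * (M n).maxSparsity)) := by gcongr
      have h5 : lam * ((2 * m n) * (MΦ * (M n).maxSparsity))
          = 2 * MΦ * lam * m n * ((M n).maxSparsity : ℝ) := by ring
      have h6 : lam2 n * ((n : ℝ) * (MΦ * (M n).dstar))
          = MΦ * (lam2 n * ((n : ℝ) * ((M n).dstar : ℝ))) := by ring
      linarith
    · rw [← ENNReal.ofReal_natCast, ← ENNReal.ofReal_mul hpn.le]
      refine ENNReal.ofReal_le_ofReal ?_
      rw [← Real.exp_log hpn, ← Real.exp_add]
      refine Real.exp_le_exp.2 ?_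
      linarith
  have hlim2 : Tendsto (fun n : ℕ => ENNReal.ofReal (Real.exp (-((n : ℝ) / 2)))
      + ENNReal.ofReal (2 / (n : ℝ))) atTop (𝓝 0) := by
    have h1 : Tendsto (fun n : ℕ => Real.exp (-((n : ℝ) / 2))) atTop (𝓝 0) :=
      Real.tendsto_exp_neg_atTop_nhds_zero.comp
        (tendsto_natCast_atTop_atTop.atTop_div_const (by norm_num))
    have h2 : Tendsto (fun n : ℕ => 2 / (n : ℝ)) atTop (𝓝 0) :=
      tendsto_const_div_atTop_nhds_zero_nat 2
    simpa using (ENNReal.tendsto_ofReal h1).add (ENNReal.tendsto_ofReal h2)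
  exact tendsto_of_tendsto_of_tendsto_of_le_of_le' tendsto_const_nhds hlim2
    (Eventually.of_forall fun _ => bot_le) hbound
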